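/- Let $p\ge 2$ and $n=2p$. For an odd integer $k$ with $1\le k\le n-1$ put $C_k=\mathrm{diag}(\underbrace{1,\dots,1}_{k},\underbrace{-1,\dots,-1}_{n-k})$, and let $\Gamma_k=\langle C_kL_{e_1/2},\,L_\lambda:\lambda\in\mathbb Z^n\rangle$ be the subgroup of the isometry group $I(\mathbb R^n)$ generated by $x\mapsto C_k(x+\tfrac12 e_1)$ and the translations $L_\lambda:x\mapsto x+\lambda$, $\lambda\in\mathbb Z^n$. A Bieberbach group is a discrete, cocompact, torsion-free subgroup $\Gamma$ of $I(\mathbb R^n)$; its holonomy group is the group of linear parts of its elements, and $M_\Gamma=\Gamma\backslash\mathbb R^n$ carries the metric induced by the Euclidean one. Two such manifolds $M_\Gamma, M_{\Gamma'}$ are $q$-isospectral if every real number has the same multiplicity (possibly $0$) as an eigenvalue of the Hodge Laplacian $d\delta+\delta d$ on smooth $q$-forms on $M_\Gamma$ and on $M_{\Gamma'}$. Then: 1. For every odd $k$ with $1\le k\le n-1$, $\Gamma_k$ is a Bieberbach group whose holonomy group is isomorphic to $\mathbb Z_2$. 2. For all odd $k\ne k'$ with $1\le k,k'\le n-1$: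 the groups $\Gamma_k$ and $\Gamma_{k'}$ are not isomorphic; the manifolds $M_{\Gamma_k}$ and $M_{\Gamma_{k'}}$ are $p$-isospectral; and they are neither $0$-isospectral nor $n$-isospectral. 3. For every odd $j$ with $1\le j\le n$, $K_p^n(j)=0$, where $K_l^n(j)=\sum_{t=0}^{l}(-1)^t\binom jt\binom{n-j}{l-t}$ are the values of the binary Krawtchouk polynomials. 4. $M_{\Gamma_1}$ and $M_{\Gamma_3}$ are not $q$-isospectral for any $q$ with $0\le q\le n$ and $q\ne p$. -/

import Mathlib

noncomputable section

namespace FlatManifold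

open scoped ContDiff

/-- The Euclidean space `ℝⁿ`. -/
abbrev E (n : ℕ) : Type := EuclideanSpace ℝ (Fin n)

/-- The group `I(ℝⁿ)` of isometries of `ℝⁿ`; the product is composition. -/
abbrev Iso (n : ℕ) : Type := E n ≃ᵃⁱ[ℝ] E n

/-! ### Bieberbach groups and their quotients -/

/-- The homomorphism `I(ℝⁿ) → O(n)` that sends `B L_b` to `B`. -/
def linearPart (n : ℕ) : Iso n →* (E n ≃ₗᵢ[ℝ] E n) where
  toFun γ := γ.linearIsometryEquiv
  map_one' := rfl
  map_mul' _ _ := rfl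

/-- The point group of `Γ`, that is, the group of the linear parts of its elements. For a
Bieberbach group it is the linear holonomy group of the flat manifold `Γ \ ℝⁿ`. -/
def holonomyGroup {n : ℕ} (Γ : Subgroup (Iso n)) : Subgroup (E n ≃ₗᵢ[ℝ] E n) :=
  Γ.map (linearPart n)

/-- The equivalence relation on `ℝⁿ` whose classes are the `Γ`-orbits. -/
def orbitSetoid {n : ℕ} (Γ : Subgroup (Iso n)) : Setoid (E n) where
  r x y := ∃ γ ∈ Γ, γ x = y
  iseqv :=
    { refl := fun _ => ⟨1, Γ.one_mem, rfl⟩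
      symm := by
        rintro x y ⟨γ, hγ, rfl⟩
        exact ⟨γ⁻¹, Γ.inv_mem hγ, γ.symm_apply_apply x⟩
      trans := by
        rintro x y z ⟨γ, hγ, rfl⟩ ⟨δ, hδ, rfl⟩
        exact ⟨δ * γ, Γ.mul_mem hδ hγ, rfl⟩ }

/-- The orbit space `M_Γ = Γ \ ℝⁿ`, with the quotient topology. -/
abbrev OrbitSpace {n : ℕ} (Γ : Subgroup (Iso n)) : Type := Quotient (orbitSetoid Γ)

/-- An isometry of `ℝⁿ` as a continuous map. The topology of `I(ℝⁿ)` is the one induced by the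
compact-open topology of `C(ℝⁿ, ℝⁿ)` through this injective map. -/
def toC {n : ℕ} (γ : Iso n) : C(E n, E n) := ⟨γ, γ.continuous⟩

/-- Bieberbach groups: discrete, cocompact, torsion-free subgroups of `I(ℝⁿ)`. -/
structure IsBieberbach {n : ℕ} (Γ : Subgroup (Iso n)) : Prop where
  discrete : DiscreteTopology (toC '' (Γ : Set (Iso n)))
  cocompact : CompactSpace (OrbitSpace Γ)
  torsionFree : ∀ γ ∈ Γ, IsOfFinOrder γ → γ = 1

/-! ### Differential forms and the Hodge Laplacian -/

/-- Real differential `q`-forms on `ℝⁿ` (without any regularity). -/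
abbrev Form (n q : ℕ) : Type := E n → (E n) [⋀^Fin q]→L[ℝ] ℝ

/-- The pullback `γ^* η` of a form by an isometry. -/
def pullback {n q : ℕ} (γ : Iso n) (η : Form n q) : Form n q :=
  fun x => (η (γ x)).compContinuousLinearMap
    (γ.linearIsometryEquiv.toContinuousLinearEquiv : E n →L[ℝ] E n)

/-- The codifferential `δ η = - ∑ i, ι_{e_i} ∇_{e_i} η` of the Euclidean metric, the formal adjoint
of the exterior derivative. -/
def codiff {n q : ℕ} (η : Form n (q + 1)) : Form n q :=
  fun x => -∑ i : Fin n, (fderiv ℝ η x (EuclideanSpace.single i 1)).curryLeft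
    (EuclideanSpace.single i 1)

/-- The (nonnegative) Hodge Laplacian `d δ + δ d` on `q`-forms, where `δ = 0` on functions. -/
def hodgeLaplacian {n : ℕ} : (q : ℕ) → Form n q → Form n q
  | 0, η => codiff (extDeriv η)
  | _ + 1, η => extDeriv (codiff η) + codiff (extDeriv η)

section Linearity

variable {n q : ℕ}

theorem extDeriv_contDiff {η : Form n q} (h : ContDiff ℝ ∞ η) : ContDiff ℝ ∞ (extDeriv η) :=
  (ContinuousAlternatingMap.alternatizeUncurryFinCLM ℝ (E n) ℝ).contDiff.comp
    (h.fderiv_right le_rfl)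

theorem codiff_contDiff {η : Form n (q + 1)} (h : ContDiff ℝ ∞ η) : ContDiff ℝ ∞ (codiff η) := by
  have h' : ContDiff ℝ ∞ (fderiv ℝ η) := h.fderiv_right le_rfl
  refine ContDiff.neg (ContDiff.sum fun i _ => ?_)
  have h1 : ContDiff ℝ ∞ fun x => fderiv ℝ η x (EuclideanSpace.single i 1) :=
    h'.clm_apply contDiff_const
  exact ((ContinuousAlternatingMap.curryLeftLI (𝕜 := ℝ) (E := E n) (F := ℝ) (n := q)).contDiff.comp h1).clm_apply
    contDiff_const

theorem extDeriv_add' {η θ : Form n q} (h : ContDiff ℝ ∞ η) (h' : ContDiff ℝ ∞ θ) :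
    extDeriv (η + θ) = extDeriv η + extDeriv θ :=
  funext fun x => extDeriv_add (h.differentiable (by simp) x) (h'.differentiable (by simp) x)

theorem extDeriv_smul' (c : ℝ) (η : Form n q) :
    extDeriv (c • η) = c • extDeriv η :=
  funext fun _ => extDeriv_smul c η

theorem codiff_add {η θ : Form n (q + 1)} (h : ContDiff ℝ ∞ η) (h' : ContDiff ℝ ∞ θ) :
    codiff (η + θ) = codiff η + codiff θ := by
  funext x
  have hd : DifferentiableAt ℝ η x := h.differentiable (by simp) x
  have hd' : DifferentiableAt ℝ θ x := h'.differentiable (by simp) x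
  have he : fderiv ℝ (η + θ) x = fderiv ℝ η x + fderiv ℝ θ x := fderiv_add hd hd'
  simp only [codiff, he, Pi.add_apply, add_apply,
    ContinuousAlternatingMap.curryLeft_add, Finset.sum_add_distrib, neg_add]

theorem codiff_smul {η : Form n (q + 1)} (c : ℝ) (h : ContDiff ℝ ∞ η) :
    codiff (c • η) = c • codiff η := by
  funext x
  have hd : DifferentiableAt ℝ η x := h.differentiable (by simp) x
  simp only [codiff, fderiv_const_smul hd, Pi.smul_apply, smul_neg, Finset.smul_sum]
  rfl

theorem hodgeLaplacian_add {η θ : Form n q} (h : ContDiff ℝ ∞ η) (h' : ContDiff ℝ ∞ θ) :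
    hodgeLaplacian q (η + θ) = hodgeLaplacian q η + hodgeLaplacian q θ := by
  cases q with
  | zero =>
    simp only [hodgeLaplacian]
    rw [extDeriv_add' h h', codiff_add (extDeriv_contDiff h) (extDeriv_contDiff h')]
  | succ q =>
    simp only [hodgeLaplacian]
    rw [extDeriv_add' h h', codiff_add (extDeriv_contDiff h) (extDeriv_contDiff h'),
      codiff_add h h', extDeriv_add' (codiff_contDiff h) (codiff_contDiff h')]
    abel

theorem hodgeLaplacian_smul {η : Form n q} (c : ℝ) (h : ContDiff ℝ ∞ η) :
    hodgeLaplacian q (c • η) = c • hodgeLaplacian q η := by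
  cases q with
  | zero =>
    simp only [hodgeLaplacian]
    rw [extDeriv_smul' c η, codiff_smul c (extDeriv_contDiff h)]
  | succ q =>
    simp only [hodgeLaplacian]
    rw [extDeriv_smul' c η, codiff_smul c (extDeriv_contDiff h), codiff_smul c h,
      extDeriv_smul' c (codiff η), smul_add]

end Linearity

/-- The smooth real `q`-forms on the flat manifold `M_Γ = Γ \ ℝⁿ`. Pulling back along the
covering `ℝⁿ → Γ \ ℝⁿ` identifies them with the smooth `q`-forms `η` on `ℝⁿ` such that `γ^* η = η`
for all `γ ∈ Γ`. -/
def quotientForms {n : ℕ} (Γ : Subgroup (Iso n)) (q : ℕ) : Submodule ℝ (Form n q) where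
  carrier := {η | ContDiff ℝ ∞ η ∧ ∀ γ ∈ Γ, pullback γ η = η}
  zero_mem' := ⟨contDiff_const, fun _ _ => rfl⟩
  add_mem' := by
    rintro η θ ⟨h, hη⟩ ⟨h', hθ⟩
    refine ⟨h.add h', fun γ hγ => ?_⟩
    conv_rhs => rw [← hη γ hγ, ← hθ γ hγ]
    rfl
  smul_mem' := by
    rintro c η ⟨h, hη⟩
    refine ⟨h.const_smul c, fun γ hγ => ?_⟩
    conv_rhs => rw [← hη γ hγ]
    rfl

/-- The `l`-eigenspace of the Hodge Laplacian on the smooth `q`-forms on `M_Γ`. The metric of `M_Γ`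
is the one induced by the Euclidean metric, so the Hodge Laplacian of `M_Γ` lifts to the Euclidean
one. -/
def hodgeEigenspace {n : ℕ} (Γ : Subgroup (Iso n)) (q : ℕ) (l : ℝ) : Submodule ℝ (Form n q) where
  carrier := {η | η ∈ quotientForms Γ q ∧ hodgeLaplacian q η = l • η}
  zero_mem' := by
    refine ⟨(quotientForms Γ q).zero_mem, ?_⟩
    have h := hodgeLaplacian_smul (n := n) (q := q) (η := 0) 0 contDiff_const
    rw [zero_smul, zero_smul] at h
    rw [h, smul_zero]
  add_mem' := by
    rintro η θ ⟨h, hη⟩ ⟨h', hθ⟩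
    refine ⟨(quotientForms Γ q).add_mem h h', ?_⟩
    rw [hodgeLaplacian_add h.1 h'.1, hη, hθ, smul_add]
  smul_mem' := by
    rintro c η ⟨h, hη⟩
    refine ⟨(quotientForms Γ q).smul_mem c h, ?_⟩
    rw [hodgeLaplacian_smul c h.1, hη, smul_comm]

/-- `M_Γ` and `M_Γ'` are `q`-isospectral: every real number has the same multiplicity as an
eigenvalue of the two Hodge Laplacians on `q`-forms. -/
def Isospectral {n : ℕ} (q : ℕ) (Γ Γ' : Subgroup (Iso n)) : Prop :=
  ∀ l : ℝ, Module.rank ℝ (hodgeEigenspace Γ q l) = Module.rank ℝ (hodgeEigenspace Γ' q l)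

/-! ### The groups of the family -/

/-- The translation `L_b : x ↦ x + b`. -/
def translation {n : ℕ} (b : E n) : Iso n := AffineIsometryEquiv.constVAdd ℝ (E n) b

/-- The diagonal map `C_k = diag(1, …, 1, -1, …, -1)` of `ℝⁿ`, with `k` entries `1`. -/
def diagC (n k : ℕ) : E n ≃ₗᵢ[ℝ] E n :=
  LinearIsometryEquiv.piLpCongrRight 2 fun i : Fin n =>
    if (i : ℕ) < k then LinearIsometryEquiv.refl ℝ ℝ else LinearIsometryEquiv.neg ℝ

/-- The vector `e₁ / 2` of `ℝⁿ`. -/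
def halfE1 (n : ℕ) : E n := WithLp.toLp 2 fun i => if (i : ℕ) = 0 then 1 / 2 else 0

/-- The vector of the canonical lattice `ℤⁿ ⊆ ℝⁿ` with coordinates `m`. -/
def latticeVec {n : ℕ} (m : Fin n → ℤ) : E n := WithLp.toLp 2 fun i => (m i : ℝ)

/-- The group `Γ_k = ⟨C_k L_{e₁/2}, ℤⁿ⟩`, where `ℤⁿ` acts by translations. -/
def groupΓ (n k : ℕ) : Subgroup (Iso n) :=
  Subgroup.closure
    ({(diagC n k).toAffineIsometryEquiv * translation (halfE1 n)} ∪
      Set.range fun m : Fin n → ℤ => translation (latticeVec m))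

/-- The value `K_l^h(j) = ∑_{t=0}^l (-1)^t C(j, t) C(h - j, l - t)` of the binary Krawtchouk
polynomial, for `j ≤ h`. -/
def krawtchouk (h l j : ℕ) : ℤ :=
  ∑ t ∈ Finset.range (l + 1), (-1) ^ t * (j.choose t : ℤ) * ((h - j).choose (l - t) : ℤ)

end FlatManifold

end

/-!
The Hodge Laplacian of flat space acts coefficientwise, as minus the sum of the second partial
derivatives (`hodgeLaplacian_eq`). The group `Γ_k` is generated by the translation lattice `ℤⁿ` and
one further element `γ = C_k L_{e₁/2}` whose square is the translation by `e₁`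
(`mem_groupΓ_iff`). An eigenform `∑ f_I dx_I` on `M_{Γ_k}` is therefore the same as a family of
Laplace eigenfunctions `f_I` on the torus `ℝⁿ / ℤⁿ` such that `f_I ∘ γ = ε_I f_I`, where `ε_I = ± 1`
is the sign of `C_k` on `dx_I` (`mem_hodgeEigenspace_iff`). Writing `V_l = V_l⁺ ⊕ V_l⁻` for the
decomposition of an eigenspace of functions under the involution `f ↦ f ∘ γ`, the multiplicity of
`l` on `q`-forms is `a dim V_l⁺ + b dim V_l⁻`, where `a` and `b` count the sets `I` of size `q` with
`ε_I = 1` and `ε_I = -1` (`rank_hodgeEigenspace`).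

For `n = 2p` and `k` odd, `C_k` has determinant `-1`, so passing to complements exchanges the two
signs among the sets of size `p`. Hence `a = b` in degree `p`, and the multiplicity is `a dim V_l`,
which does not depend on `k` (`isospectral_middle`).

The other degrees are separated by the eigenvalues `0` and `4π²`. Integration by parts on the torus
shows that the Fourier coefficients of an eigenfunction vanish off the frequencies `m` with
`4π²|m|² = l` (`eq_sum_exp_of_partialLaplacian`). So `V_0` consists of the constants, and for
`l = 4π²` the functions `cos (2π x_i)`, `sin (2π x_i)` form a basis of eigenvectors of the
involution, with `dim V⁺ = n + k - 2` and `dim V⁻ = n - k + 2`. In the degrees `0` and `n` one of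
`a`, `b` vanishes, which distinguishes all `k`. For `k = 1` and `k' = 3`, equal multiplicities of
both eigenvalues force `a = b`, and for `k = 1` this means `2q = n`
(`not_isospectral_one_three`).

The groups themselves are distinguished by their centers: the center of `Γ_k` consists of the
translations by vectors of `ℤⁿ` fixed by `C_k`, a free abelian group of rank `k`
(`centerHom_bijective`). The vanishing of the Krawtchouk values reflects the same symmetry as the
isospectrality: the substitution `t ↦ j - t` exchanges terms of opposite sign
(`krawtchouk_eq_zero`).
-/

noncomputable section

namespace FlatManifold

open scoped ContDiff

/-! ### The groups `Γ_k` -/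

/-- The generator `C_k L_{e₁/2}` of `Γ_k`. -/
def glide (n k : ℕ) : Iso n :=
  (diagC n k).toAffineIsometryEquiv * translation (halfE1 n)

/-- The `i`-th diagonal entry of `C_k`. -/
def diagSign (k i : ℕ) : ℤ := if i < k then 1 else -1

theorem diagSign_mul_self (k i : ℕ) : diagSign k i * diagSign k i = 1 := by
  unfold diagSign; split_ifs <;> simp

theorem diagC_apply {n k : ℕ} (x : E n) (i : Fin n) :
    diagC n k x i = (diagSign k i : ℝ) * x i := by
  simp only [diagC, diagSign, LinearIsometryEquiv.piLpCongrRight_apply]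
  split_ifs <;> simp

theorem diagC_single {n k : ℕ} (i : Fin n) :
    diagC n k (EuclideanSpace.single i 1) =
      (diagSign k i : ℝ) • EuclideanSpace.single i 1 := by
  ext j
  rw [diagC_apply]
  rcases eq_or_ne j i with rfl | h <;> simp [*]

theorem translation_apply {n : ℕ} (b x : E n) : translation b x = b + x := rfl

theorem glide_apply {n k : ℕ} (x : E n) (i : Fin n) :
    glide n k x i = (diagSign k i : ℝ) * (halfE1 n i + x i) := by
  change diagC n k (halfE1 n + x) i = _
  rw [diagC_apply]; rfl

theorem latticeVec_apply {n : ℕ} (m : Fin n → ℤ) (i : Fin n) : latticeVec m i = m i := rfl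

theorem halfE1_apply {n : ℕ} (i : Fin n) : halfE1 n i = if (i : ℕ) = 0 then 1 / 2 else 0 := rfl

/-- The coordinates of `e₁`. -/
def latticeE1 (n : ℕ) : Fin n → ℤ := fun i => if (i : ℕ) = 0 then 1 else 0

theorem iso_ext {n : ℕ} {γ δ : Iso n} (h : ∀ x i, γ x i = δ x i) : γ = δ :=
  AffineIsometryEquiv.ext fun x => by ext i; exact h x i

theorem mul_apply' {n : ℕ} (γ δ : Iso n) (x : E n) : (γ * δ) x = γ (δ x) := rfl

theorem translation_mul {n : ℕ} (b c : E n) :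
    translation b * translation c = translation (b + c) :=
  iso_ext fun x i => by simp [mul_apply', translation_apply, add_assoc]

theorem translation_zero {n : ℕ} : translation (0 : E n) = 1 :=
  iso_ext fun x i => by simp [translation_apply]

theorem translation_pow {n : ℕ} (b : E n) (r : ℕ) :
    translation b ^ r = translation ((r : ℝ) • b) := by
  induction r with
  | zero => simp [translation_zero]
  | succ r ih => rw [pow_succ, ih, translation_mul]; congr 1; push_cast; module

theorem latticeVec_add {n : ℕ} (m m' : Fin n → ℤ) :
    latticeVec (m + m') = latticeVec m + latticeVec m' := by
  ext i; simp [latticeVec_apply]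

theorem glide_mul_translation {n k : ℕ} (m : Fin n → ℤ) :
    glide n k * translation (latticeVec m) =
      translation (latticeVec fun i => diagSign k i * m i) * glide n k :=
  iso_ext fun x i => by
    simp only [mul_apply', translation_apply, glide_apply, PiLp.add_apply, latticeVec_apply]
    push_cast; ring

/-- The square of `C_k L_{e₁/2}` is the translation by `e₁`, since `C_k` fixes `e₁`. -/
theorem glide_mul_glide {n k : ℕ} (hk : 0 < k) :
    glide n k * glide n k = translation (latticeVec (latticeE1 n)) :=
  iso_ext fun x i => by
    simp only [mul_apply', translation_apply, glide_apply, PiLp.add_apply, latticeVec_apply,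
      halfE1_apply, latticeE1]
    have h : (diagSign k i : ℝ) * diagSign k i = 1 := mod_cast diagSign_mul_self k i
    by_cases hi : (i : ℕ) = 0
    · simp only [hi, if_true]; simp [diagSign, hk]; ring
    · simp only [hi, if_false, zero_add, Int.cast_zero]
      rw [← mul_assoc, h, one_mul]

theorem glide_mem (n k : ℕ) : glide n k ∈ groupΓ n k :=
  Subgroup.subset_closure (Or.inl rfl)

theorem translation_mem {n k : ℕ} (m : Fin n → ℤ) :
    translation (latticeVec m) ∈ groupΓ n k :=
  Subgroup.subset_closure (Or.inr ⟨m, rfl⟩)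

theorem translation_latticeVec_inv {n : ℕ} (m : Fin n → ℤ) :
    (translation (latticeVec m))⁻¹ = translation (latticeVec (-m)) := by
  rw [inv_eq_iff_mul_eq_one, translation_mul, ← latticeVec_add, add_neg_cancel,
    ← translation_zero]
  congr 1; ext i; simp [latticeVec_apply]

/-- The normal form of the elements of `Γ_k`: the translation lattice has index two, and the other
coset is represented by the generator `C_k L_{e₁/2}`. -/
theorem mem_groupΓ_iff {n k : ℕ} (hk : 0 < k) {γ : Iso n} :
    γ ∈ groupΓ n k ↔ ∃ m : Fin n → ℤ, γ = translation (latticeVec m) ∨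
      γ = translation (latticeVec m) * glide n k := by
  constructor
  · intro h
    induction h using Subgroup.closure_induction with
    | mem γ h =>
      rcases h with h | ⟨m, rfl⟩
      · refine ⟨0, Or.inr ?_⟩
        rw [show latticeVec (0 : Fin n → ℤ) = 0 by ext i; simp [latticeVec_apply],
          translation_zero, one_mul]
        exact h
      · exact ⟨m, Or.inl rfl⟩
    | one =>
      refine ⟨0, Or.inl ?_⟩
      rw [show latticeVec (0 : Fin n → ℤ) = 0 by ext i; simp [latticeVec_apply],
        translation_zero]
    | mul γ δ _ _ hγ hδ =>
      obtain ⟨m, rfl | rfl⟩ := hγ <;> obtain ⟨m', rfl | rfl⟩ := hδ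
      · exact ⟨m + m', Or.inl (by rw [translation_mul, latticeVec_add])⟩
      · exact ⟨m + m', Or.inr (by rw [← mul_assoc, translation_mul, latticeVec_add])⟩
      · exact ⟨_, Or.inr (by rw [mul_assoc, glide_mul_translation, ← mul_assoc,
          translation_mul, ← latticeVec_add])⟩
      · exact ⟨_, Or.inl (by rw [mul_assoc, ← mul_assoc (glide n k), glide_mul_translation,
          mul_assoc, glide_mul_glide hk, translation_mul, translation_mul, ← latticeVec_add,
          ← latticeVec_add])⟩
    | inv γ _ hγ =>
      obtain ⟨m, rfl | rfl⟩ := hγ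
      · exact ⟨-m, Or.inl (translation_latticeVec_inv m)⟩
      · have hg : (glide n k)⁻¹ = translation (latticeVec (-latticeE1 n)) * glide n k := by
          refine inv_eq_of_mul_eq_one_left ?_
          rw [mul_assoc, glide_mul_glide hk, ← translation_latticeVec_inv, inv_mul_cancel]
        exact ⟨_, Or.inr (by rw [mul_inv_rev, translation_latticeVec_inv, hg, mul_assoc,
          glide_mul_translation, ← mul_assoc, translation_mul, ← latticeVec_add])⟩
  · rintro ⟨m, rfl | rfl⟩
    · exact translation_mem m
    · exact mul_mem (translation_mem m) (glide_mem n k)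

/-! ### `Γ_k` is a Bieberbach group with holonomy group `ℤ₂` -/

theorem latticeVec_injective {n : ℕ} :
    Function.Injective (latticeVec : (Fin n → ℤ) → E n) := fun m m' h => by
  funext i
  have := congrArg (fun x : E n => x i) h
  simpa [latticeVec_apply] using this

/-- Outside the translation lattice, the elements of `Γ_k` move the origin to points whose first
coordinate is an integer plus `1/2`. -/
theorem two_mul_apply_zero {n k : ℕ} (hk : 0 < k) (m : Fin n → ℤ) (i : Fin n) :
    (2 * (translation (latticeVec m) * glide n k) (0 : E n) i : ℝ) =
      ((2 * m i + latticeE1 n i : ℤ) : ℝ) := by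
  simp only [mul_apply', translation_apply, glide_apply, PiLp.add_apply, latticeVec_apply,
      halfE1_apply, latticeE1, PiLp.zero_apply, add_zero]
  by_cases hi : (i : ℕ) = 0
  · simp only [hi, if_true]; simp [diagSign, hk]; ring
  · simp [hi]

theorem exists_twice_apply_zero {n k : ℕ} (hk : 0 < k) {γ : Iso n} (hγ : γ ∈ groupΓ n k) :
    ∃ z : Fin n → ℤ, ∀ i, 2 * γ 0 i = z i := by
  obtain ⟨m, rfl | rfl⟩ := (mem_groupΓ_iff hk).1 hγ
  · exact ⟨fun i => 2 * m i, fun i => by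
      rw [translation_apply, add_zero, latticeVec_apply]; push_cast; rfl⟩
  · exact ⟨fun i => 2 * m i + latticeE1 n i, two_mul_apply_zero hk m⟩

/-- The first coordinate of `γ 0` tells the two cosets of the translation lattice apart, so an
element of `Γ_k` is determined by its value at the origin. -/
theorem eq_of_apply_zero_eq {n k : ℕ} (hn : 0 < n) (hk : 0 < k) {γ δ : Iso n}
    (hγ : γ ∈ groupΓ n k) (hδ : δ ∈ groupΓ n k) (h : γ 0 = δ 0) : γ = δ := by
  have key : ∀ m m' : Fin n → ℤ,
      translation (latticeVec m) (0 : E n) ≠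
        (translation (latticeVec m') * glide n k) (0 : E n) := fun m m' h => by
    have h0 := congrArg (fun x : E n => 2 * x ⟨0, hn⟩) h
    simp only at h0
    rw [two_mul_apply_zero hk, translation_apply, add_zero, latticeVec_apply] at h0
    have h1 : 2 * m ⟨0, hn⟩ = 2 * m' ⟨0, hn⟩ + latticeE1 n ⟨0, hn⟩ := mod_cast h0
    simp only [latticeE1, if_true] at h1
    omega
  obtain ⟨m, rfl | rfl⟩ := (mem_groupΓ_iff hk).1 hγ <;>
    obtain ⟨m', rfl | rfl⟩ := (mem_groupΓ_iff hk).1 hδ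
  · rw [translation_apply, translation_apply, add_zero, add_zero] at h
    rw [h]
  · exact (key _ _ h).elim
  · exact (key _ _ h.symm).elim
  · rw [mul_apply', mul_apply', translation_apply, translation_apply] at h
    rw [add_right_cancel h]

theorem discrete_groupΓ {n k : ℕ} (hn : 0 < n) (hk : 0 < k) :
    DiscreteTopology (toC '' (groupΓ n k : Set (Iso n))) := by
  -- Twice the image of the origin is an injective continuous `ℤⁿ`-valued invariant.
  have hex : ∀ f : toC '' (groupΓ n k : Set (Iso n)),
      ∃ z : Fin n → ℤ, ∀ i, 2 * f.1 0 i = z i := by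
    rintro ⟨_, γ, hγ, rfl⟩
    exact exists_twice_apply_zero hk hγ
  choose z hz using hex
  have hcont : Continuous z := by
    refine continuous_pi fun i => ?_
    refine Int.isClosedEmbedding_coe_real.isEmbedding.continuous_iff.2 ?_
    have : (Int.cast ∘ fun f => z f i : _ → ℝ) = fun f => 2 * f.1 0 i :=
      funext fun f => (hz f i).symm
    rw [this]
    have h1 : Continuous fun f : toC '' (groupΓ n k : Set (Iso n)) => f.1 (0 : E n) :=
      (continuous_eval_const (0 : E n)).comp continuous_subtype_val
    fun_prop
  refine DiscreteTopology.of_continuous_injective hcont ?_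
  rintro ⟨_, γ, hγ, rfl⟩ ⟨_, δ, hδ, rfl⟩ h
  have : γ = δ := eq_of_apply_zero_eq hn hk hγ hδ <| by
    ext i
    have h1 := hz ⟨_, γ, hγ, rfl⟩ i
    rw [h, ← hz ⟨_, δ, hδ, rfl⟩ i] at h1
    exact mul_left_cancel₀ two_ne_zero h1
  subst this; rfl

theorem cocompact_groupΓ (n k : ℕ) : CompactSpace (OrbitSpace (groupΓ n k)) := by
  have hK : IsCompact (Set.Icc (0 : Fin n → ℝ) 1) := isCompact_Icc
  have hc : Continuous fun x : Fin n → ℝ =>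
      (Quotient.mk (orbitSetoid (groupΓ n k)) (WithLp.toLp 2 x)) :=
    continuous_quotient_mk'.comp (PiLp.continuous_toLp 2 _)
  -- The unit cube meets every orbit of the translation lattice.
  refine ⟨?_⟩
  convert! hK.image hc
  refine (Set.eq_univ_of_forall fun y => ?_).symm
  obtain ⟨x, rfl⟩ := Quotient.exists_rep y
  refine ⟨fun i => Int.fract (x i), ⟨fun i => Int.fract_nonneg _,
    fun i => (Int.fract_lt_one _).le⟩, Quotient.sound ?_⟩
  refine ⟨translation (latticeVec fun i => ⌊x i⌋), translation_mem _, ?_⟩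
  ext i
  exact Int.floor_add_fract (x i)

theorem not_isOfFinOrder_translation {n : ℕ} {b : E n} (hb : b ≠ 0) :
    ¬ IsOfFinOrder (translation b) := by
  rw [isOfFinOrder_iff_pow_eq_one]
  rintro ⟨r, hr, h⟩
  rw [translation_pow] at h
  have h0 := congrArg (fun γ : Iso n => γ 0) h
  simp only [translation_apply, add_zero, AffineIsometryEquiv.coe_one, id_eq] at h0
  rcases smul_eq_zero.1 h0 with h1 | h1
  · exact hr.ne' (mod_cast h1)
  · exact hb h1

/-- The square of an element outside the translation lattice is a translation with odd first
coordinate. -/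
theorem torsionFree_groupΓ {n k : ℕ} (hn : 0 < n) (hk : 0 < k) {γ : Iso n}
    (hγ : γ ∈ groupΓ n k) (h : IsOfFinOrder γ) : γ = 1 := by
  obtain ⟨m, rfl | rfl⟩ := (mem_groupΓ_iff hk).1 hγ
  · by_contra hne
    refine not_isOfFinOrder_translation (fun h0 => hne ?_) h
    rw [h0, translation_zero]
  · exfalso
    have h2 := h.pow (n := 2)
    rw [pow_two, mul_assoc, ← mul_assoc (glide n k), glide_mul_translation, mul_assoc,
      glide_mul_glide hk, translation_mul, translation_mul, ← latticeVec_add,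
      ← latticeVec_add] at h2
    refine not_isOfFinOrder_translation (fun h0 => ?_) h2
    have h1 := congrArg (fun x : E n => x ⟨0, hn⟩) h0
    simp only [latticeVec_apply, PiLp.zero_apply, Pi.add_apply, Int.cast_eq_zero] at h1
    simp [diagSign, hk, latticeE1] at h1
    omega

theorem isBieberbach_groupΓ {n k : ℕ} (hn : 0 < n) (hk : 0 < k) : IsBieberbach (groupΓ n k) :=
  ⟨discrete_groupΓ hn hk, cocompact_groupΓ n k, fun _ => torsionFree_groupΓ hn hk⟩

theorem linearPart_translation {n : ℕ} (b : E n) : linearPart n (translation b) = 1 := rfl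

theorem linearPart_glide (n k : ℕ) : linearPart n (glide n k) = diagC n k := by
  rw [glide, map_mul, linearPart_translation, mul_one]; rfl

theorem diagC_ne_one {n k : ℕ} (hkn : k < n) : diagC n k ≠ 1 := fun h => by
  have h1 := congrArg (fun f : E n ≃ₗᵢ[ℝ] E n => f (EuclideanSpace.single ⟨k, hkn⟩ 1) ⟨k, hkn⟩) h
  simp only [diagC_apply] at h1
  norm_num [diagSign] at h1

theorem coe_holonomyGroup {n k : ℕ} (hk : 0 < k) :
    (holonomyGroup (groupΓ n k) : Set (E n ≃ₗᵢ[ℝ] E n)) = {1, diagC n k} := by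
  ext B
  simp only [holonomyGroup, Subgroup.coe_map, Set.mem_image, SetLike.mem_coe,
    Set.mem_insert_iff, Set.mem_singleton_iff]
  constructor
  · rintro ⟨γ, hγ, rfl⟩
    obtain ⟨m, rfl | rfl⟩ := (mem_groupΓ_iff hk).1 hγ
    · exact Or.inl (linearPart_translation _)
    · exact Or.inr (by rw [map_mul, linearPart_translation, one_mul, linearPart_glide])
  · rintro (rfl | rfl)
    · exact ⟨1, one_mem _, map_one _⟩
    · exact ⟨_, glide_mem n k, linearPart_glide n k⟩

theorem nonempty_holonomyGroup_mulEquiv {n k : ℕ} (hk : 0 < k) (hkn : k < n) :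
    Nonempty (holonomyGroup (groupΓ n k) ≃* Multiplicative (ZMod 2)) := by
  have h1 : Nat.card (holonomyGroup (groupΓ n k)) = 2 := by
    change Nat.card (holonomyGroup (groupΓ n k) : Set (E n ≃ₗᵢ[ℝ] E n)) = 2
    rw [coe_holonomyGroup hk, Nat.card_coe_set_eq, Set.ncard_pair (diagC_ne_one hkn).symm]
  have h2 : Nat.card (Multiplicative (ZMod 2)) = 2 := Nat.card_zmod 2
  exact ⟨mulEquivOfPrimeCardEq (p := 2) h1 h2⟩

/-! ### The center of `Γ_k` -/

/-- The inclusion of `ℤᵏ` into `ℤⁿ` as the span of the first `k` basis vectors, for `k ≤ n`. -/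
def extendZero {k : ℕ} (n : ℕ) (v : Fin k → ℤ) : Fin n → ℤ :=
  fun i => if h : (i : ℕ) < k then v ⟨i, h⟩ else 0

theorem diagSign_mul_extendZero {n k : ℕ} (v : Fin k → ℤ) (i : Fin n) :
    diagSign k i * extendZero n v i = extendZero n v i := by
  by_cases h : (i : ℕ) < k <;> simp [diagSign, extendZero, h]

theorem translation_extendZero_mem_center {n k : ℕ} (hk : 0 < k) (v : Fin k → ℤ) :
    (⟨translation (latticeVec (extendZero n v)), translation_mem _⟩ : groupΓ n k) ∈
      Subgroup.center (groupΓ n k) := by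
  rw [Subgroup.mem_center_iff]
  rintro ⟨γ, hγ⟩
  refine Subtype.ext ?_
  change γ * translation _ = translation _ * γ
  obtain ⟨m, rfl | rfl⟩ := (mem_groupΓ_iff hk).1 hγ
  · rw [translation_mul, translation_mul, add_comm]
  · rw [mul_assoc, glide_mul_translation, ← mul_assoc, ← mul_assoc, translation_mul,
      translation_mul, add_comm]
    simp only [diagSign_mul_extendZero]

/-- The homomorphism from `ℤᵏ` to the center of `Γ_k` that sends `v` to the translation by `v`,
where `ℤᵏ` is the sublattice of `ℤⁿ` fixed by `C_k`. -/
def centerHom {n k : ℕ} (hk : 0 < k) :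
    Multiplicative (Fin k → ℤ) →* Subgroup.center (groupΓ n k) :=
  MonoidHom.mk' (fun v => ⟨_, translation_extendZero_mem_center hk v.toAdd⟩) fun v w => by
    refine Subtype.ext (Subtype.ext ?_)
    change translation _ = translation _ * translation _
    rw [translation_mul, ← latticeVec_add]
    congr 2
    funext i
    by_cases h : (i : ℕ) < k <;> simp [extendZero, h]

/-- A central translation commutes with `C_k L_{e₁/2}` only if `C_k` fixes its vector, and an
element with linear part `C_k` does not commute with the translation by `e_{k+1}`, which `C_k` inverts. -/
theorem centerHom_bijective {n k : ℕ} (hk : 0 < k) (hkn : k < n) :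
    Function.Bijective (centerHom (n := n) hk) := by
  constructor
  · intro v w h
    have h1 : translation (latticeVec (extendZero n v.toAdd)) =
      translation (latticeVec (extendZero n w.toAdd)) :=
        congrArg (fun z : Subgroup.center (groupΓ n k) => (z.1 : Iso n)) h
    have h2 := congrArg (fun γ : Iso n => γ 0) h1
    simp only [translation_apply, add_zero] at h2
    have h3 := latticeVec_injective h2
    refine Multiplicative.toAdd.injective (funext fun i => ?_)
    have h4 := congrFun h3 ⟨i, i.2.trans hkn⟩
    simpa [extendZero] using h4
  · rintro ⟨⟨γ, hγ⟩, hc⟩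
    rw [Subgroup.mem_center_iff] at hc
    have hc' : ∀ δ ∈ groupΓ n k, ∀ x i, δ (γ x) i = γ (δ x) i := fun δ hδ x i =>
      congrArg (fun z : groupΓ n k => (z : Iso n) x i) (hc ⟨δ, hδ⟩)
    obtain ⟨m, rfl | rfl⟩ := (mem_groupΓ_iff hk).1 hγ
    · refine ⟨Multiplicative.ofAdd fun i => m ⟨i, i.2.trans hkn⟩, ?_⟩
      refine Subtype.ext (Subtype.ext ?_)
      change translation (latticeVec (extendZero n _)) = translation (latticeVec m)
      congr 2
      funext i
      by_cases h : (i : ℕ) < k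
      · simp [extendZero, h]
      · have h1 := hc' _ (glide_mem n k) 0 i
        have h0 : (i : ℕ) ≠ 0 := by omega
        simp [translation_apply, glide_apply, latticeVec_apply, halfE1_apply, h0, diagSign,
          h] at h1
        have h2 : m i = 0 := by exact_mod_cast (by linarith : (m i : ℝ) = 0)
        simp [extendZero, h, h2]
    · exfalso
      have h1 := hc' _ (translation_mem (Pi.single ⟨k, hkn⟩ 1)) 0 ⟨k, hkn⟩
      simp [mul_apply', translation_apply, glide_apply, latticeVec_apply, diagSign] at h1
      linarith

theorem isEmpty_groupΓ_mulEquiv {n k k' : ℕ} (hk : 0 < k) (hkn : k < n) (hk' : 0 < k')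
    (hkn' : k' < n) (hne : k ≠ k') : IsEmpty (groupΓ n k ≃* groupΓ n k') := by
  refine ⟨fun e => hne ?_⟩
  let f : Multiplicative (Fin k → ℤ) ≃* Multiplicative (Fin k' → ℤ) :=
    ((MulEquiv.ofBijective _ (centerHom_bijective hk hkn)).trans (Subgroup.centerCongr e)).trans
      (MulEquiv.ofBijective _ (centerHom_bijective hk' hkn')).symm
  have h := (AddEquiv.toMultiplicative.symm f).toIntLinearEquiv.finrank_eq
  simpa using h

/-! ### Krawtchouk values at odd points -/

theorem krawtchouk_eq_zero {p j : ℕ} (hj : Odd j) (hjp : j ≤ 2 * p) :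
    krawtchouk (2 * p) p j = 0 := by
  -- The substitution `t ↦ j - t` preserves both binomial coefficients and changes the sign.
  have hsub : krawtchouk (2 * p) p j =
      ∑ t ∈ (Finset.range (p + 1)).filter (fun t => t ≤ j ∧ j ≤ p + t),
        (-1) ^ t * (j.choose t : ℤ) * ((2 * p - j).choose (p - t) : ℤ) := by
    rw [krawtchouk, Finset.sum_filter_of_ne]
    intro t ht h
    rw [Finset.mem_range] at ht
    constructor
    · by_contra h1
      exact h (by rw [Nat.choose_eq_zero_of_lt (by omega : j < t)]; simp)
    · by_contra h1
      exact h (by rw [Nat.choose_eq_zero_of_lt (by omega : 2 * p - j < p - t)]; simp)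
  have hneg : krawtchouk (2 * p) p j = -krawtchouk (2 * p) p j := by
    conv_lhs => rw [hsub]
    rw [hsub, ← Finset.sum_neg_distrib]
    refine Finset.sum_bij' (fun t _ => j - t) (fun t _ => j - t) ?_ ?_ ?_ ?_ ?_
    · simp only [Finset.mem_filter, Finset.mem_range]; omega
    · simp only [Finset.mem_filter, Finset.mem_range]; omega
    · simp only [Finset.mem_filter, Finset.mem_range]; omega
    · simp only [Finset.mem_filter, Finset.mem_range]; omega
    · simp only [Finset.mem_filter, Finset.mem_range]
      rintro t ⟨h1, h2, h3⟩
      rw [Nat.choose_symm h2, ← Nat.choose_symm (by omega : p - t ≤ 2 * p - j),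
        show 2 * p - j - (p - t) = p - (j - t) by omega]
      have hs : (-1 : ℤ) ^ t = -(-1) ^ (j - t) := by
        have h4 : (-1 : ℤ) ^ t * (-1) ^ (j - t) = -1 := by
          rw [← pow_add, Nat.add_sub_cancel' h2, hj.neg_one_pow]
        rcases neg_one_pow_eq_or ℤ t with h5 | h5 <;> rw [h5] at h4 ⊢ <;> linarith
      rw [hs]; ring
  linarith

/-! ### The Hodge Laplacian in coordinates -/

/-- The sum `∑ i, ∂_i² f` of the pure second partial derivatives of a vector-valued function on
`ℝⁿ`. -/
def partialLaplacian {n : ℕ} {F : Type*} [NormedAddCommGroup F] [NormedSpace ℝ F]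
    (f : E n → F) (x : E n) : F :=
  ∑ i : Fin n, fderiv ℝ (fderiv ℝ f) x (EuclideanSpace.single i 1) (EuclideanSpace.single i 1)

theorem hasFDerivAt_clm_comp {V F G : Type*} [NormedAddCommGroup V] [NormedSpace ℝ V]
    [NormedAddCommGroup F] [NormedSpace ℝ F] [NormedAddCommGroup G] [NormedSpace ℝ G]
    (L : F →L[ℝ] G) {f : V → F} {f' : V →L[ℝ] F} {x : V} (hf : HasFDerivAt f f' x) :
    HasFDerivAt (fun y => L (f y)) (L.comp f') x :=
  L.hasFDerivAt.comp x hf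

/-- The exterior derivative is the composition of the total derivative with a constant linear map,
so its derivative is obtained by antisymmetrizing the second derivative. -/
theorem fderiv_extDeriv {n q : ℕ} {η : Form n q} (h : ContDiff ℝ ∞ η) (x u : E n) :
    fderiv ℝ (extDeriv η) x u =
      ContinuousAlternatingMap.alternatizeUncurryFin (fderiv ℝ (fderiv ℝ η) x u) := by
  have h' : DifferentiableAt ℝ (fderiv ℝ η) x :=
    (h.fderiv_right (m := ∞) le_rfl).differentiable (by simp) x
  have h2 : HasFDerivAt (extDeriv η) ((ContinuousAlternatingMap.alternatizeUncurryFinCLM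
      ℝ (E n) ℝ (n := q)).comp (fderiv ℝ (fderiv ℝ η) x)) x :=
    hasFDerivAt_clm_comp (V := E n) (F := E n →L[ℝ] (E n) [⋀^Fin q]→L[ℝ] ℝ) (f := fderiv ℝ η)
      (f' := fderiv ℝ (fderiv ℝ η) x) _ h'.hasFDerivAt
  rw [h2.fderiv]; rfl

theorem fderiv_codiff {n q : ℕ} {η : Form n (q + 1)} (h : ContDiff ℝ ∞ η) (x u : E n) :
    fderiv ℝ (codiff η) x u = -∑ i : Fin n,
      (fderiv ℝ (fderiv ℝ η) x u (EuclideanSpace.single i 1)).curryLeft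
        (EuclideanSpace.single i 1) := by
  have h' : DifferentiableAt ℝ (fderiv ℝ η) x :=
    (h.fderiv_right (m := ∞) le_rfl).differentiable (by simp) x
  let c : Fin n → (E n →L[ℝ] (E n) [⋀^Fin (q + 1)]→L[ℝ] ℝ) →L[ℝ] (E n) [⋀^Fin q]→L[ℝ] ℝ :=
    fun i => (ContinuousLinearMap.apply ℝ _ (EuclideanSpace.single i 1)).comp
      (((ContinuousAlternatingMap.curryLeftLI (𝕜 := ℝ) (E := E n) (F := ℝ)
        (n := q)).toContinuousLinearMap).comp
        (ContinuousLinearMap.apply ℝ _ (EuclideanSpace.single i 1)))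
  have hi : ∀ i, HasFDerivAt (fun y => c i (fderiv ℝ η y))
      ((c i).comp (fderiv ℝ (fderiv ℝ η) x)) x := fun i =>
    hasFDerivAt_clm_comp (V := E n) (F := E n →L[ℝ] (E n) [⋀^Fin (q + 1)]→L[ℝ] ℝ)
      (f := fderiv ℝ η) (f' := fderiv ℝ (fderiv ℝ η) x) _ h'.hasFDerivAt
  have h1 : HasFDerivAt (codiff η) _ x :=
    (HasFDerivAt.fun_sum (u := Finset.univ) fun i _ => hi i).fun_neg
  rw [h1.fderiv]
  simp [c]

/-- The Weitzenböck formula of flat space: the Hodge Laplacian acts coefficientwise. -/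
theorem hodgeLaplacian_eq {n q : ℕ} {η : Form n q} (h : ContDiff ℝ ∞ η) :
    hodgeLaplacian q η = -partialLaplacian η := by
  have hcodiff : ∀ x (v : Fin q → E n), codiff (extDeriv η) x v =
      -∑ i : Fin n, ∑ j : Fin (q + 1), (-1) ^ (j : ℕ) *
        fderiv ℝ (fderiv ℝ η) x (EuclideanSpace.single i 1)
          ((Fin.cons (EuclideanSpace.single i 1) v : Fin (q + 1) → E n) j)
          (j.removeNth (Fin.cons (EuclideanSpace.single i 1) v : Fin (q + 1) → E n)) := by
    intro x v
    simp only [codiff, fderiv_extDeriv h]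
    simp [ContinuousAlternatingMap.sum_apply, Matrix.vecCons,
      ContinuousAlternatingMap.alternatizeUncurryFin_apply]
  cases q with
  | zero =>
    funext x
    ext v
    change codiff (extDeriv η) x v = _
    rw [hcodiff]
    simp [partialLaplacian, ContinuousAlternatingMap.sum_apply]
  | succ q =>
    funext x
    ext v
    change extDeriv (codiff η) x v + codiff (extDeriv η) x v = _
    have hsymm : ∀ u w, fderiv ℝ (fderiv ℝ η) x u w = fderiv ℝ (fderiv ℝ η) x w u := fun u w =>
      (h.contDiffAt.isSymmSndFDerivAt
        (by simpa using WithTop.coe_le_coe.2 (le_top : (2 : ℕ∞) ≤ ⊤))).eq u w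
    -- The terms of `δ d` with both derivatives along `e_i` give the Laplacian; the others cancel
    -- against `d δ` by the symmetry of second derivatives.
    have hd : extDeriv (codiff η) x v = ∑ i : Fin n, ∑ j : Fin (q + 1), -((-1) ^ (j : ℕ) *
        fderiv ℝ (fderiv ℝ η) x (v j) (EuclideanSpace.single i 1)
          (Fin.cons (EuclideanSpace.single i 1) (j.removeNth v) : Fin (q + 1) → E n)) := by
      rw [extDeriv, ContinuousAlternatingMap.alternatizeUncurryFin_apply, Finset.sum_comm]
      simp only [fderiv_codiff h]
      simp [ContinuousAlternatingMap.sum_apply, Matrix.vecCons, Finset.mul_sum]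
    rw [hd, hcodiff]
    have hr : ∀ (u : E n) (j : Fin (q + 1)),
        (j.succ.removeNth (Fin.cons u v : Fin (q + 2) → E n)) = Fin.cons u (j.removeNth v) :=
      fun u j => by
        funext i
        refine Fin.cases ?_ (fun i => ?_) i <;> simp [Fin.removeNth]
    simp only [Fin.sum_univ_succ (n := q + 1), hr, Fin.cons_succ, Finset.sum_add_distrib, neg_add]
    simp only [hsymm (EuclideanSpace.single _ 1) (v _)]
    simp [partialLaplacian, ContinuousAlternatingMap.sum_apply, pow_succ]

/-! ### Fourier analysis of lattice-periodic functions -/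

/-- Functions on `ℝⁿ` that are invariant under the translations by `ℤⁿ`. -/
def IsPeriodic {n : ℕ} {F : Type*} (f : E n → F) : Prop :=
  ∀ (m : Fin n → ℤ) (x : E n), f (latticeVec m + x) = f x

/-- The projection `ℝⁿ → ℝⁿ / ℤⁿ`. -/
def torusProj {n : ℕ} (x : E n) : UnitAddTorus (Fin n) := fun i => (x i : UnitAddCircle)

theorem torusProj_add {n : ℕ} (x y : E n) : torusProj (x + y) = torusProj x + torusProj y :=
  rfl

theorem isQuotientMap_torusProj (n : ℕ) :
    Topology.IsQuotientMap (torusProj : E n → UnitAddTorus (Fin n)) := by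
  have h : IsOpenQuotientMap (Pi.map fun (_ : Fin n) (x : ℝ) => (x : UnitAddCircle)) :=
    IsOpenQuotientMap.piMap fun _ => QuotientAddGroup.isOpenQuotientMap_mk
  exact h.isQuotientMap.comp (PiLp.homeomorph 2 fun _ : Fin n => ℝ).isQuotientMap

/-- An arbitrarily chosen representative in `ℝⁿ` of a point of the torus. -/
def torusRep {n : ℕ} (t : UnitAddTorus (Fin n)) : E n :=
  WithLp.toLp 2 fun i => Quotient.out (t i)

theorem torusProj_torusRep {n : ℕ} (t : UnitAddTorus (Fin n)) : torusProj (torusRep t) = t :=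
  funext fun i => Quotient.out_eq (t i)

theorem IsPeriodic.eq_of_torusProj_eq {n : ℕ} {F : Type*} {f : E n → F} (hf : IsPeriodic f)
    {x y : E n} (h : torusProj x = torusProj y) : f x = f y := by
  have h1 : ∀ i, ∃ m : ℤ, m • (1 : ℝ) = x i - y i := fun i => by
    rw [← AddCircle.coe_eq_zero_iff, AddCircle.coe_sub, sub_eq_zero]
    exact congrFun h i
  choose m hm using h1
  rw [← hf m y]
  congr 1
  ext i
  have := hm i
  simp only [zsmul_eq_mul, mul_one] at this
  simp [latticeVec_apply, this]

/-- The function on the torus induced by a function on `ℝⁿ`. For periodic functions it does not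
depend on the choice of representatives. -/
def descend {n : ℕ} {F : Type*} (f : E n → F) (t : UnitAddTorus (Fin n)) : F := f (torusRep t)

theorem IsPeriodic.descend_torusProj {n : ℕ} {F : Type*} {f : E n → F} (hf : IsPeriodic f)
    (x : E n) : descend f (torusProj x) = f x :=
  hf.eq_of_torusProj_eq (torusProj_torusRep _)

theorem IsPeriodic.continuous_descend {n : ℕ} {F : Type*} [TopologicalSpace F] {f : E n → F}
    (hf : IsPeriodic f) (hc : Continuous f) : Continuous (descend f) := by
  rw [(isQuotientMap_torusProj n).continuous_iff]
  have h : descend f ∘ torusProj = f := funext hf.descend_torusProj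
  rwa [h]

theorem IsPeriodic.fderiv_apply {n : ℕ} {F : Type*} [NormedAddCommGroup F] [NormedSpace ℝ F]
    {f : E n → F} (hf : IsPeriodic f) (u : E n) : IsPeriodic fun x => fderiv ℝ f x u := by
  intro m x
  have h : (fun y => f (latticeVec m + y)) = f := funext (hf m)
  have h1 := fderiv_comp_add_left (𝕜 := ℝ) (f := f) (x := x) (latticeVec m)
  rw [h] at h1
  simp only [h1]

/-- The invariant probability measure on the torus, with respect to which Mathlib's Fourier
coefficients are defined. -/
abbrev torusMeasure (n : ℕ) : MeasureTheory.Measure (UnitAddTorus (Fin n)) :=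
  MeasureTheory.Measure.pi fun _ => AddCircle.haarAddCircle

theorem contDiff_fderiv_apply {n : ℕ} {F : Type*} [NormedAddCommGroup F] [NormedSpace ℝ F]
    {f : E n → F} (h : ContDiff ℝ ∞ f) (u : E n) : ContDiff ℝ ∞ fun x => fderiv ℝ f x u :=
  (h.fderiv_right le_rfl).clm_apply contDiff_const

theorem IsPeriodic.integrable_descend {n : ℕ} {f : E n → ℂ} (hf : IsPeriodic f)
    (hc : Continuous f) : MeasureTheory.Integrable (descend f) (torusMeasure n) :=
  (hf.continuous_descend hc).integrable_of_hasCompactSupport (HasCompactSupport.of_compactSpace _)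

/-- A directional derivative of a periodic function has mean value zero: the mean value of the
translates of the function does not depend on the translation. -/
theorem integral_descend_fderiv {n : ℕ} {f : E n → ℂ} (hf : IsPeriodic f)
    (hs : ContDiff ℝ ∞ f) (u : E n) :
    ∫ t, descend (fun x => fderiv ℝ f x u) t ∂torusMeasure n = 0 := by
  have hc := hf.continuous_descend hs.continuous
  have hc' := (hf.fderiv_apply u).continuous_descend (contDiff_fderiv_apply hs u).continuous
  obtain ⟨C, hC⟩ : ∃ C, ∀ t, ‖descend (fun x => fderiv ℝ f x u) t‖ ≤ C := by
    obtain ⟨C, hC⟩ := isCompact_univ.exists_bound_of_continuousOn hc'.continuousOn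
    exact ⟨C, fun t => hC t trivial⟩
  have hint : ∀ {g : UnitAddTorus (Fin n) → ℂ}, Continuous g →
      MeasureTheory.Integrable g (torusMeasure n) := fun hg =>
    hg.integrable_of_hasCompactSupport (HasCompactSupport.of_compactSpace _)
  have hcs : ∀ (s : ℝ) {g : UnitAddTorus (Fin n) → ℂ}, Continuous g →
      Continuous fun t => g (t + torusProj (s • u)) := fun s g hg => by fun_prop
  have key := hasDerivAt_integral_of_dominated_loc_of_deriv_le (𝕜 := ℝ) (μ := torusMeasure n)
    (F := fun s t => descend f (t + torusProj (s • u)))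
    (F' := fun s t => descend (fun x => fderiv ℝ f x u) (t + torusProj (s • u)))
    (x₀ := 0) (s := Set.univ) (bound := fun _ => C) Filter.univ_mem
    (Filter.Eventually.of_forall fun s => (hint (hcs s hc)).aestronglyMeasurable)
    (hint (hcs 0 hc)) (hint (hcs 0 hc')).aestronglyMeasurable
    (Filter.Eventually.of_forall fun t s _ => hC _)
    (MeasureTheory.integrable_const C)
    (Filter.Eventually.of_forall fun t s _ => by
      have h1 : ∀ s : ℝ, t + torusProj (s • u) = torusProj (torusRep t + s • u) := fun s => by
        rw [torusProj_add, torusProj_torusRep]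
      simp only [h1, hf.descend_torusProj, (hf.fderiv_apply u).descend_torusProj]
      have h2 : HasDerivAt (fun s : ℝ => torusRep t + s • u) u s := by
        simpa using ((hasDerivAt_id s).smul_const u).const_add (torusRep t)
      exact (hs.differentiable (by simp) _).hasFDerivAt.comp_hasDerivAt s h2)
  have h0 := key.2
  simp only [MeasureTheory.integral_add_right_eq_self] at h0
  exact (h0.unique (hasDerivAt_const _ _))

/-- The linear form `x ↦ 2πi m·x`. -/
def phase {n : ℕ} (m : Fin n → ℤ) : E n →L[ℝ] ℂ :=
  ∑ i, (2 * Real.pi * Complex.I * m i : ℂ) • (Complex.ofRealCLM.comp (EuclideanSpace.proj i))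

theorem phase_apply {n : ℕ} (m : Fin n → ℤ) (x : E n) :
    phase m x = ∑ i, 2 * Real.pi * Complex.I * m i * x i := by
  simp [phase]

theorem exp_phase {n : ℕ} (m : Fin n → ℤ) (x : E n) :
    Complex.exp (phase m x) = UnitAddTorus.mFourier m (torusProj x) := by
  rw [phase_apply, Complex.exp_sum]
  simp only [UnitAddTorus.mFourier, torusProj, ContinuousMap.coe_mk, fourier_coe_apply]
  simp

theorem phase_single {n : ℕ} (m : Fin n → ℤ) (i : Fin n) :
    phase m (EuclideanSpace.single i 1) = 2 * Real.pi * Complex.I * m i := by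
  rw [phase_apply, Finset.sum_eq_single i]
  · simp
  · intro j _ hj; simp [hj]
  · simp

/-- The `m`-th Fourier coefficient of a periodic function on `ℝⁿ`, for a frequency `m ∈ ℤⁿ`. -/
def coeff {n : ℕ} (f : E n → ℂ) (m : Fin n → ℤ) : ℂ :=
  UnitAddTorus.mFourierCoeff (descend f) m

theorem coeff_eq_integral {n : ℕ} (f : E n → ℂ) (m : Fin n → ℤ) :
    coeff f m = ∫ t, descend (fun x => Complex.exp (phase (-m) x) * f x) t ∂torusMeasure n := by
  change ∫ t, UnitAddTorus.mFourier (-m) t • descend f t ∂torusMeasure n = _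
  congr 1
  funext t
  simp only [descend, exp_phase, torusProj_torusRep, smul_eq_mul]

theorem IsPeriodic.exp_phase_mul {n : ℕ} {f : E n → ℂ} (hf : IsPeriodic f) (m : Fin n → ℤ) :
    IsPeriodic fun x => Complex.exp (phase m x) * f x := fun m' x => by
  have h : torusProj (latticeVec m' + x) = torusProj x := by
    rw [torusProj_add, add_eq_right]
    funext i
    exact (AddCircle.coe_eq_zero_iff 1).2 ⟨m' i, by simp [latticeVec_apply]⟩
  simp only [exp_phase, h, hf m' x]

theorem IsPeriodic.integrable_exp_phase_mul {n : ℕ} {f : E n → ℂ} (hf : IsPeriodic f)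
    (hc : Continuous f) (m : Fin n → ℤ) :
    MeasureTheory.Integrable (descend fun x => Complex.exp (phase m x) * f x) (torusMeasure n) :=
  (hf.exp_phase_mul m).integrable_descend (by fun_prop)

/-- Integration by parts: a partial derivative multiplies the Fourier coefficients by `2πi m_i`. -/
theorem coeff_fderiv {n : ℕ} {f : E n → ℂ} (hf : IsPeriodic f) (hs : ContDiff ℝ ∞ f)
    (m : Fin n → ℤ) (i : Fin n) :
    coeff (fun x => fderiv ℝ f x (EuclideanSpace.single i 1)) m =
      2 * Real.pi * Complex.I * m i * coeff f m := by
  have hper := hf.exp_phase_mul (-m)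
  have hsm : ContDiff ℝ ∞ fun x => Complex.exp (phase (-m) x) * f x :=
    ((phase (-m)).contDiff.cexp).mul hs
  have h0 := integral_descend_fderiv hper hsm (EuclideanSpace.single i 1)
  have h1 : ∀ x, fderiv ℝ (fun x => Complex.exp (phase (-m) x) * f x) x
      (EuclideanSpace.single i 1) =
      Complex.exp (phase (-m) x) * fderiv ℝ f x (EuclideanSpace.single i 1) -
      2 * Real.pi * Complex.I * m i * (Complex.exp (phase (-m) x) * f x) := fun x => by
    have h2 := ((phase (-m)).hasFDerivAt (x := x)).cexp.mul
      (hs.differentiable (by simp) x).hasFDerivAt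
    rw [show (fun x => Complex.exp (phase (-m) x) * f x) =
      (fun x => Complex.exp (phase (-m) x)) * f from rfl, h2.fderiv]
    simp [phase_single]
    ring
  simp only [h1] at h0
  rw [coeff_eq_integral, coeff_eq_integral, ← MeasureTheory.integral_const_mul, ← sub_eq_zero,
    ← MeasureTheory.integral_sub]
  · exact h0
  · exact (hf.fderiv_apply _).integrable_exp_phase_mul (contDiff_fderiv_apply hs _).continuous _
  · exact (hf.integrable_exp_phase_mul hs.continuous _).const_mul _

theorem partialLaplacian_eq_sum {n : ℕ} {F : Type*} [NormedAddCommGroup F] [NormedSpace ℝ F]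
    {f : E n → F} (h : ContDiff ℝ ∞ f) (x : E n) :
    partialLaplacian f x = ∑ i : Fin n, fderiv ℝ
      (fun y => fderiv ℝ f y (EuclideanSpace.single i 1)) x (EuclideanSpace.single i 1) := by
  have h' : DifferentiableAt ℝ (fderiv ℝ f) x :=
    (h.fderiv_right (m := ∞) le_rfl).differentiable (by simp) x
  refine Finset.sum_congr rfl fun i _ => ?_
  rw [fderiv_clm_apply h' (differentiableAt_const _)]
  simp

theorem partialLaplacian_clm_comp {n : ℕ} {F G : Type*} [NormedAddCommGroup F] [NormedSpace ℝ F]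
    [NormedAddCommGroup G] [NormedSpace ℝ G] (L : F →L[ℝ] G) {f : E n → F}
    (h : ContDiff ℝ ∞ f) (x : E n) :
    partialLaplacian (fun y => L (f y)) x = L (partialLaplacian f x) := by
  have h1 : fderiv ℝ (fun y => L (f y)) = fun y => L.comp (fderiv ℝ f y) := funext fun y =>
    (hasFDerivAt_clm_comp L (h.differentiable (by simp) y).hasFDerivAt).fderiv
  have h' : DifferentiableAt ℝ (fderiv ℝ f) x :=
    (h.fderiv_right (m := ∞) le_rfl).differentiable (by simp) x
  have h2 : fderiv ℝ (fun y => L.comp (fderiv ℝ f y)) x = _ :=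
    (hasFDerivAt_clm_comp (ContinuousLinearMap.compL ℝ (E n) F G L) h'.hasFDerivAt).fderiv
  simp only [partialLaplacian, h1, h2, map_sum]
  rfl

theorem coeff_eq_zero {n : ℕ} {f : E n → ℂ} (hf : IsPeriodic f) (hs : ContDiff ℝ ∞ f) {l : ℝ}
    (hl : ∀ x, partialLaplacian f x = -(l * f x)) (m : Fin n → ℤ)
    (hm : 4 * Real.pi ^ 2 * ∑ i, (m i : ℝ) ^ 2 ≠ l) : coeff f m = 0 := by
  have h2 : ∀ i, coeff (fun x => fderiv ℝ (fun y => fderiv ℝ f y (EuclideanSpace.single i 1)) x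
      (EuclideanSpace.single i 1)) m =
      (2 * Real.pi * Complex.I * m i) ^ 2 * coeff f m := fun i => by
    rw [coeff_fderiv (hf.fderiv_apply _) (contDiff_fderiv_apply hs _), coeff_fderiv hf hs]
    ring
  have h3 : ∑ i, (2 * Real.pi * Complex.I * m i) ^ 2 * coeff f m = -(l * coeff f m) := by
    simp only [← h2]
    simp only [coeff_eq_integral]
    rw [← MeasureTheory.integral_finsetSum, ← MeasureTheory.integral_const_mul,
      ← MeasureTheory.integral_neg]
    · congr 1
      funext t
      simp only [descend]
      rw [← Finset.mul_sum, ← partialLaplacian_eq_sum hs, hl]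
      ring
    · exact fun i _ => ((hf.fderiv_apply _).fderiv_apply _).integrable_exp_phase_mul
        (contDiff_fderiv_apply (contDiff_fderiv_apply hs _) _).continuous _
  have h4 : ((4 * Real.pi ^ 2 * ∑ i, (m i : ℝ) ^ 2 - l : ℝ) : ℂ) * coeff f m = 0 := by
    have h5 : ∑ i, (2 * Real.pi * Complex.I * m i) ^ 2 * coeff f m =
        -(4 * Real.pi ^ 2 * ∑ i, (m i : ℂ) ^ 2) * coeff f m := by
      rw [Finset.mul_sum, ← Finset.sum_neg_distrib, Finset.sum_mul]
      refine Finset.sum_congr rfl fun i _ => ?_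
      rw [mul_pow, mul_pow, Complex.I_sq]; ring
    rw [h5] at h3
    push_cast
    linear_combination -h3
  refine (mul_eq_zero.1 h4).resolve_left fun h5 => hm ?_
  exact sub_eq_zero.1 (Complex.ofReal_eq_zero.1 h5)

/-- An eigenfunction of the Laplacian on the torus is a trigonometric polynomial whose
frequencies are the lattice vectors of the length prescribed by the eigenvalue. -/
theorem eq_sum_exp_of_partialLaplacian {n : ℕ} {f : E n → ℝ} (hf : IsPeriodic f)
    (hs : ContDiff ℝ ∞ f) {l : ℝ} (hl : ∀ x, partialLaplacian f x = -(l * f x))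
    (S : Finset (Fin n → ℤ))
    (hS : ∀ m : Fin n → ℤ, 4 * Real.pi ^ 2 * ∑ i, (m i : ℝ) ^ 2 = l → m ∈ S) :
    ∃ c : (Fin n → ℤ) → ℂ, ∀ x, (f x : ℂ) = ∑ m ∈ S, c m * Complex.exp (phase m x) := by
  let g : E n → ℂ := fun x => Complex.ofRealCLM (f x)
  have hgs : ContDiff ℝ ∞ g := Complex.ofRealCLM.contDiff.comp hs
  have hgp : IsPeriodic g := fun m x => congrArg Complex.ofRealCLM (hf m x)
  have hgl : ∀ x, partialLaplacian g x = -(l * g x) := fun x => by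
    rw [partialLaplacian_clm_comp _ hs, hl]; simp [g]
  let G : C(UnitAddTorus (Fin n), ℂ) := ⟨descend g, hgp.continuous_descend hgs.continuous⟩
  have h0 : ∀ m ∉ S, coeff g m = 0 := fun m hm =>
    coeff_eq_zero hgp hgs hgl m fun h => hm (hS m h)
  have hsum : Summable (UnitAddTorus.mFourierCoeff G) :=
    summable_of_ne_finset_zero (s := S) h0
  refine ⟨coeff g, fun x => ?_⟩
  have h1 := UnitAddTorus.hasSum_mFourier_series_apply_of_summable hsum (torusProj x)
  have h2 : G (torusProj x) = (f x : ℂ) := hgp.descend_torusProj x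
  rw [h2] at h1
  refine h1.unique ?_
  simp only [exp_phase]
  exact hasSum_sum_of_ne_finset_zero fun m hm => by
    change coeff g m • _ = 0
    rw [h0 m hm, zero_smul]

/-! ### Coordinates of differential forms -/

/-- The coordinate vectors `e_i`, `i ∈ I`, in increasing order of `i`. -/
def frame {n q : ℕ} (I : Set.powersetCard (Fin n) q) : Fin q → E n :=
  fun j => EuclideanSpace.single (Set.powersetCard.ofFinEmbEquiv.symm I j) 1

/-- The elementary form `dx_I`. Its value at `v` is a minor of the matrix of coordinates of `v`,
which gives the continuity. -/
def elementaryForm {n q : ℕ} (I : Set.powersetCard (Fin n) q) : (E n) [⋀^Fin q]→L[ℝ] ℝ where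
  toAlternatingMap := exteriorPower.alternatingMapLinearEquiv.symm
    (exteriorPower.ιMultiDual ℝ q (EuclideanSpace.basisFun (Fin n) ℝ).toBasis I)
  cont := by
    have h : ∀ v : Fin q → E n, exteriorPower.alternatingMapLinearEquiv.symm
        (exteriorPower.ιMultiDual ℝ q (EuclideanSpace.basisFun (Fin n) ℝ).toBasis I) v =
        (Matrix.of fun i j => v i (Set.powersetCard.ofFinEmbEquiv.symm I j)).det := fun v => by
      rw [exteriorPower.alternatingMapLinearEquiv_symm_apply, LinearMap.compAlternatingMap_apply,
        exteriorPower.ιMultiDual_apply_ιMulti]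
      rfl
    refine (Continuous.matrix_det (A := fun v : Fin q → E n =>
      Matrix.of fun i j => v i (Set.powersetCard.ofFinEmbEquiv.symm I j)) ?_).congr
        fun v => (h v).symm
    refine continuous_matrix fun i j => ?_
    simp only [Matrix.of_apply]
    fun_prop

theorem ιMulti_frame {n q : ℕ} (I : Set.powersetCard (Fin n) q) :
    exteriorPower.ιMulti ℝ q (frame I) =
      exteriorPower.ιMulti_family ℝ q (EuclideanSpace.basisFun (Fin n) ℝ).toBasis I := by
  rw [exteriorPower.ιMulti_family]
  congr 1
  funext j
  simp [frame]

theorem elementaryForm_frame {n q : ℕ} (I J : Set.powersetCard (Fin n) q) :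
    elementaryForm I (frame J) = if I = J then 1 else 0 := by
  change exteriorPower.alternatingMapLinearEquiv.symm _ (frame J) = _
  rw [exteriorPower.alternatingMapLinearEquiv_symm_apply, LinearMap.compAlternatingMap_apply,
    ιMulti_frame]
  split_ifs with h
  · rw [h, exteriorPower.ιMultiDual_apply_diag]
  · rw [exteriorPower.ιMultiDual_apply_nondiag _ _ _ _ _ h]

/-- The coordinates of an alternating form with respect to the elementary forms. -/
def formCoord (n q : ℕ) :
    ((E n) [⋀^Fin q]→L[ℝ] ℝ) →ₗ[ℝ] (Set.powersetCard (Fin n) q → ℝ) where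
  toFun α I := α (frame I)
  map_add' _ _ := rfl
  map_smul' _ _ := rfl

theorem formCoord_bijective (n q : ℕ) : Function.Bijective (formCoord n q) := by
  constructor
  · intro α α' h
    have h1 : exteriorPower.alternatingMapLinearEquiv α.toAlternatingMap =
        exteriorPower.alternatingMapLinearEquiv α'.toAlternatingMap := by
      refine ((EuclideanSpace.basisFun (Fin n) ℝ).toBasis.exteriorPower q).ext fun I => ?_
      rw [exteriorPower.basis_apply, ← ιMulti_frame,
        exteriorPower.alternatingMapLinearEquiv_apply_ιMulti,
        exteriorPower.alternatingMapLinearEquiv_apply_ιMulti]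
      exact congrFun h I
    exact ContinuousAlternatingMap.toAlternatingMap_injective
      (exteriorPower.alternatingMapLinearEquiv.injective h1)
  · intro c
    refine ⟨∑ I, c I • elementaryForm I, funext fun J => ?_⟩
    change (∑ I, c I • elementaryForm I) (frame J) = c J
    simp [ContinuousAlternatingMap.sum_apply, elementaryForm_frame]

instance finiteDimensional_forms (n q : ℕ) :
    FiniteDimensional ℝ ((E n) [⋀^Fin q]→L[ℝ] ℝ) :=
  FiniteDimensional.of_injective (formCoord n q) (formCoord_bijective n q).1

/-- The coordinates with respect to the elementary forms as an isomorphism. -/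
def formEquiv (n q : ℕ) :
    ((E n) [⋀^Fin q]→L[ℝ] ℝ) ≃L[ℝ] (Set.powersetCard (Fin n) q → ℝ) :=
  (LinearEquiv.ofBijective _ (formCoord_bijective n q)).toContinuousLinearEquiv

/-- The `I`-th coordinate as a continuous linear form. -/
def formProj {n q : ℕ} (I : Set.powersetCard (Fin n) q) : ((E n) [⋀^Fin q]→L[ℝ] ℝ) →L[ℝ] ℝ :=
  (ContinuousLinearMap.proj I).comp (formEquiv n q).toContinuousLinearMap

theorem formProj_apply {n q : ℕ} (α : (E n) [⋀^Fin q]→L[ℝ] ℝ)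
    (I : Set.powersetCard (Fin n) q) : formProj I α = α (frame I) := rfl

theorem form_ext {n q : ℕ} {α α' : (E n) [⋀^Fin q]→L[ℝ] ℝ}
    (h : ∀ I, formProj I α = formProj I α') : α = α' :=
  (formEquiv n q).injective (funext h)

/-- The product of the diagonal entries of `C_k` with index in `s`. -/
def subsetSign {n : ℕ} (k : ℕ) (s : Finset (Fin n)) : ℤ := ∏ i ∈ s, diagSign k i

/-- The sign by which `C_k` acts on `dx_I`. -/
def formSign {n q : ℕ} (k : ℕ) (I : Set.powersetCard (Fin n) q) : ℤ :=
  subsetSign k (I : Finset (Fin n))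

theorem formSign_mul_self {n q : ℕ} (k : ℕ) (I : Set.powersetCard (Fin n) q) :
    formSign k I * formSign k I = 1 := by
  rw [formSign, subsetSign, ← Finset.prod_mul_distrib]
  exact Finset.prod_eq_one fun i _ => diagSign_mul_self k i

theorem formSign_eq_prod {n q : ℕ} (k : ℕ) (I : Set.powersetCard (Fin n) q) :
    formSign k I = ∏ j : Fin q, diagSign k (Set.powersetCard.ofFinEmbEquiv.symm I j : Fin n) := by
  have h : (I : Finset (Fin n)) = Finset.univ.map
      (Set.powersetCard.ofFinEmbEquiv.symm I : Fin q ↪o Fin n).toEmbedding := by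
    ext i
    rw [Set.powersetCard.mem_coe_iff, ← Set.powersetCard.mem_range_ofFinEmbEquiv_symm_iff_mem]
    simp
  rw [formSign, subsetSign, h, Finset.prod_map]
  rfl

theorem formProj_pullback_glide {n q k : ℕ} (η : Form n q) (x : E n)
    (I : Set.powersetCard (Fin n) q) :
    formProj I (pullback (glide n k) η x) = formSign k I * formProj I (η (glide n k x)) := by
  have h : ∀ v, (glide n k).linearIsometryEquiv v = diagC n k v := fun v => by
    rw [← linearPart_glide]; rfl
  rw [formProj_apply, formProj_apply, formSign_eq_prod]
  change η (glide n k x) (fun j => (glide n k).linearIsometryEquiv (frame I j)) = _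
  simp only [h, frame, diagC_single]
  rw [ContinuousAlternatingMap.map_smul_univ, smul_eq_mul]
  push_cast
  rfl

theorem pullback_translation {n q : ℕ} (b : E n) (η : Form n q) (x : E n) :
    pullback (translation b) η x = η (b + x) := rfl

theorem pullback_mul {n q : ℕ} (γ δ : Iso n) (η : Form n q) :
    pullback (γ * δ) η = pullback δ (pullback γ η) := rfl

/-! ### Eigenfunctions on the torus -/

section LaplacianLinear

variable {n : ℕ} {f g : E n → ℝ}

theorem partialLaplacian_add (hf : ContDiff ℝ ∞ f) (hg : ContDiff ℝ ∞ g) (x : E n) :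
    partialLaplacian (f + g) x = partialLaplacian f x + partialLaplacian g x := by
  have h1 : fderiv ℝ (f + g) = fderiv ℝ f + fderiv ℝ g := funext fun y =>
    fderiv_add (hf.differentiable (by simp) y) (hg.differentiable (by simp) y)
  have h2 := fderiv_add ((hf.fderiv_right (m := ∞) le_rfl).differentiable (by simp) x)
    ((hg.fderiv_right (m := ∞) le_rfl).differentiable (by simp) x)
  simp [partialLaplacian, h1, h2, Finset.sum_add_distrib]

theorem partialLaplacian_smul (c : ℝ) (hf : ContDiff ℝ ∞ f) (x : E n) :
    partialLaplacian (c • f) x = c * partialLaplacian f x :=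
  partialLaplacian_clm_comp (c • ContinuousLinearMap.id ℝ ℝ) hf x

end LaplacianLinear

/-- The eigenfunctions of the Laplacian on the torus `ℝⁿ / ℤⁿ` with eigenvalue `l`. -/
def torusEigenspace (n : ℕ) (l : ℝ) : Submodule ℝ (E n → ℝ) where
  carrier := {f | ContDiff ℝ ∞ f ∧ IsPeriodic f ∧ ∀ x, partialLaplacian f x = -(l * f x)}
  zero_mem' := ⟨contDiff_const, fun _ _ => rfl, fun x => by
    have := partialLaplacian_smul (f := (0 : E n → ℝ)) 0 contDiff_const x
    rw [zero_smul, zero_mul] at this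
    simp [this]⟩
  add_mem' := by
    rintro f g ⟨h1, h2, h3⟩ ⟨h1', h2', h3'⟩
    refine ⟨h1.add h1', fun m x => ?_, fun x => ?_⟩
    · simp [h2 m x, h2' m x]
    · rw [partialLaplacian_add h1 h1', h3, h3', Pi.add_apply]; ring
  smul_mem' := by
    rintro c f ⟨h1, h2, h3⟩
    refine ⟨h1.const_smul c, fun m x => ?_, fun x => ?_⟩
    · simp [h2 m x]
    · rw [partialLaplacian_smul c h1, h3, Pi.smul_apply, smul_eq_mul]; ring

/-- The functions that are multiplied by `ε` under composition with the generator
`C_k L_{e₁/2}`. -/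
def glideSpace (n k : ℕ) (ε : ℤ) : Submodule ℝ (E n → ℝ) where
  carrier := {f | ∀ x, f (glide n k x) = ε * f x}
  zero_mem' := fun x => by simp
  add_mem' := by
    intro f g hf hg x
    simp [hf x, hg x, mul_add]
  smul_mem' := by
    intro c f hf x
    simp [hf x, mul_left_comm]

/-- The eigenforms on `M_{Γ_k}` are those forms whose coordinates `f_I` are eigenfunctions on the
torus on which the generator `C_k L_{e₁/2}` acts by the sign of `C_k` on `dx_I`. -/
theorem mem_hodgeEigenspace_iff {n k q : ℕ} (hk : 0 < k) {l : ℝ} {η : Form n q} :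
    η ∈ hodgeEigenspace (groupΓ n k) q l ↔
      ∀ I, (fun x => formProj I (η x)) ∈ torusEigenspace n l ⊓ glideSpace n k (formSign k I) := by
  have hsq : ∀ I : Set.powersetCard (Fin n) q, (formSign k I : ℝ) * formSign k I = 1 :=
    fun I => mod_cast formSign_mul_self k I
  constructor
  · rintro ⟨⟨hs, hinv⟩, hl⟩ I
    refine ⟨⟨(formProj I).contDiff.comp hs, fun m x => ?_, fun x => ?_⟩, fun x => ?_⟩
    · have := congrFun (hinv _ (translation_mem m)) x
      rw [pullback_translation] at this
      simp only [this]
    · rw [partialLaplacian_clm_comp _ hs]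
      rw [hodgeLaplacian_eq hs] at hl
      have := congrFun hl x
      rw [Pi.neg_apply, neg_eq_iff_eq_neg] at this
      rw [this]
      simp
    · have := congrArg (formProj I) (congrFun (hinv _ (glide_mem n k)) x)
      rw [formProj_pullback_glide] at this
      simp only
      rw [← this, ← mul_assoc, hsq, one_mul]
  · intro h
    have hs : ContDiff ℝ ∞ η := by
      have h1 : ContDiff ℝ ∞ fun x => (formEquiv n q) (η x) :=
        contDiff_pi.2 fun I => (h I).1.1
      have h2 := (formEquiv n q).symm.contDiff (n := ∞) |>.comp h1
      have h3 : (formEquiv n q).symm ∘ (fun x => (formEquiv n q) (η x)) = η :=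
        funext fun x => (formEquiv n q).symm_apply_apply _
      rwa [h3] at h2
    have ht : ∀ m, pullback (translation (latticeVec m)) η = η := fun m => by
      funext x
      exact form_ext fun I => (h I).1.2.1 m x
    have hg : pullback (glide n k) η = η := by
      funext x
      refine form_ext fun I => ?_
      have := (h I).2 x
      simp only at this
      rw [formProj_pullback_glide, this, ← mul_assoc, hsq, one_mul]
    refine ⟨⟨hs, fun γ hγ => ?_⟩, ?_⟩
    · obtain ⟨m, rfl | rfl⟩ := (mem_groupΓ_iff hk).1 hγ
      · exact ht m
      · rw [pullback_mul, ht, hg]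
    · rw [hodgeLaplacian_eq hs]
      funext x
      refine form_ext fun I => ?_
      have := (h I).1.2.2 x
      rw [partialLaplacian_clm_comp _ hs] at this
      simp [this]

/-- The decomposition of the space of eigenforms on `M_{Γ_k}` into spaces of functions. -/
def hodgeEigenspaceEquiv {n k q : ℕ} (hk : 0 < k) (l : ℝ) :
    hodgeEigenspace (groupΓ n k) q l ≃ₗ[ℝ]
      ((I : Set.powersetCard (Fin n) q) →
        (torusEigenspace n l ⊓ glideSpace n k (formSign k I) : Submodule ℝ (E n → ℝ))) where
  toFun η I := ⟨fun x => formProj I (η.1 x), (mem_hodgeEigenspace_iff hk).1 η.2 I⟩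
  map_add' η θ := by
    funext I; refine Subtype.ext (funext fun x => ?_); exact map_add (formProj I) _ _
  map_smul' c η := by
    funext I; refine Subtype.ext (funext fun x => ?_); exact map_smul (formProj I) _ _
  invFun f := ⟨fun x => (formEquiv n q).symm fun I => (f I).1 x,
    (mem_hodgeEigenspace_iff hk).2 fun I => by
      have h : (fun x => formProj I ((formEquiv n q).symm fun I => (f I).1 x)) = (f I).1 :=
        funext fun x => congrFun ((formEquiv n q).apply_symm_apply _) I
      rw [h]
      exact (f I).2⟩
  left_inv η := Subtype.ext (funext fun x => (formEquiv n q).symm_apply_apply _)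
  right_inv f := funext fun I => Subtype.ext (funext fun x =>
    congrFun ((formEquiv n q).apply_symm_apply _) I)

/-! ### The multiplicity formula -/

theorem hasFDerivAt_glide {n k : ℕ} (x : E n) :
    HasFDerivAt (glide n k) ((diagC n k).toContinuousLinearEquiv : E n →L[ℝ] E n) x :=
  ((diagC n k).toContinuousLinearEquiv : E n →L[ℝ] E n).hasFDerivAt.comp x
    ((hasFDerivAt_id x).const_add (halfE1 n))

theorem contDiff_glide (n k : ℕ) : ContDiff ℝ ∞ (glide n k) :=
  (diagC n k).contDiff.comp (contDiff_const.add contDiff_id)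

theorem fderiv_comp_glide {n k : ℕ} {f : E n → ℝ} (hf : ContDiff ℝ ∞ f) (x : E n) (i : Fin n) :
    fderiv ℝ (fun y => f (glide n k y)) x (EuclideanSpace.single i 1) =
      diagSign k i * fderiv ℝ f (glide n k x) (EuclideanSpace.single i 1) := by
  have h := (hf.differentiable (by simp) (glide n k x)).hasFDerivAt.comp x
    (hasFDerivAt_glide (k := k) x)
  have h1 : fderiv ℝ (fun y => f (glide n k y)) x = _ := h.fderiv
  rw [h1]
  change fderiv ℝ f (glide n k x) (diagC n k (EuclideanSpace.single i 1)) = _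
  rw [diagC_single, map_smul, smul_eq_mul]

theorem partialLaplacian_comp_glide {n k : ℕ} {f : E n → ℝ} (hf : ContDiff ℝ ∞ f) (x : E n) :
    partialLaplacian (fun y => f (glide n k y)) x = partialLaplacian f (glide n k x) := by
  have hs : ContDiff ℝ ∞ fun y => f (glide n k y) := hf.comp (contDiff_glide n k)
  rw [partialLaplacian_eq_sum hs, partialLaplacian_eq_sum hf]
  refine Finset.sum_congr rfl fun i _ => ?_
  have h := contDiff_fderiv_apply hf (EuclideanSpace.single i 1)
  simp only [fderiv_comp_glide hf]
  have h' : DifferentiableAt ℝ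
      (fun y => fderiv ℝ f (glide n k y) (EuclideanSpace.single i 1)) x :=
    (h.comp (contDiff_glide n k)).differentiable (by simp) x
  rw [fderiv_const_mul h',
    smul_apply, fderiv_comp_glide h, smul_eq_mul, ← mul_assoc]
  rw [show (diagSign k i : ℝ) * diagSign k i = 1 from mod_cast diagSign_mul_self k i, one_mul]

theorem comp_glide_mem_torusEigenspace {n k : ℕ} {l : ℝ} {f : E n → ℝ}
    (hf : f ∈ torusEigenspace n l) : (fun x => f (glide n k x)) ∈ torusEigenspace n l := by
  refine ⟨hf.1.comp (contDiff_glide n k), fun m x => ?_, fun x => ?_⟩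
  · change f ((glide n k * translation (latticeVec m)) x) = _
    rw [glide_mul_translation]
    exact hf.2.1 _ _
  · rw [partialLaplacian_comp_glide hf.1, hf.2.2]

theorem comp_glide_glide {n k : ℕ} (hk : 0 < k) {l : ℝ} {f : E n → ℝ}
    (hf : f ∈ torusEigenspace n l) (x : E n) : f (glide n k (glide n k x)) = f x := by
  change f ((glide n k * glide n k) x) = _
  rw [glide_mul_glide hk]
  exact hf.2.1 _ _

/-- The generator `C_k L_{e₁/2}` acts as an involution on the eigenfunctions of the torus, so each
eigenspace is the direct sum of its symmetric and antisymmetric parts. -/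
theorem rank_add_rank_eq_rank_torusEigenspace {n k : ℕ} (hk : 0 < k) (l : ℝ) :
    Module.rank ℝ (torusEigenspace n l ⊓ glideSpace n k 1 : Submodule ℝ (E n → ℝ)) +
      Module.rank ℝ (torusEigenspace n l ⊓ glideSpace n k (-1) : Submodule ℝ (E n → ℝ)) =
      Module.rank ℝ (torusEigenspace n l) := by
  have hinf : (torusEigenspace n l ⊓ glideSpace n k 1) ⊓
      (torusEigenspace n l ⊓ glideSpace n k (-1)) = ⊥ := by
    rw [eq_bot_iff]
    rintro f ⟨⟨_, h1⟩, _, h2⟩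
    refine (Submodule.mem_bot ℝ).2 (funext fun x => ?_)
    have h1 := h1 x
    have h2 := h2 x
    push_cast at h1 h2
    rw [Pi.zero_apply]
    linarith
  have hsup : (torusEigenspace n l ⊓ glideSpace n k 1) ⊔
      (torusEigenspace n l ⊓ glideSpace n k (-1)) = torusEigenspace n l := by
    refine le_antisymm (sup_le inf_le_left inf_le_left) fun f hf => ?_
    have hg := comp_glide_mem_torusEigenspace (k := k) hf
    refine Submodule.mem_sup.2 ⟨(1 / 2 : ℝ) • (f + fun x => f (glide n k x)),
      ⟨Submodule.smul_mem _ _ (Submodule.add_mem _ hf hg), fun x => ?_⟩,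
      (1 / 2 : ℝ) • (f - fun x => f (glide n k x)),
      ⟨Submodule.smul_mem _ _ (Submodule.sub_mem _ hf hg), fun x => ?_⟩, ?_⟩
    · simp only [Pi.smul_apply, Pi.add_apply, comp_glide_glide hk hf, smul_eq_mul]
      push_cast; ring
    · simp only [Pi.smul_apply, Pi.sub_apply, comp_glide_glide hk hf, smul_eq_mul]
      push_cast; ring
    · module
  have h := Submodule.rank_sup_add_rank_inf_eq
    (torusEigenspace n l ⊓ glideSpace n k 1) (torusEigenspace n l ⊓ glideSpace n k (-1))
  rw [hinf, hsup, rank_bot, add_zero] at h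
  exact h.symm

theorem diagSign_eq_or (k i : ℕ) : diagSign k i = 1 ∨ diagSign k i = -1 := by
  unfold diagSign; split_ifs <;> simp

theorem subsetSign_eq_or {n : ℕ} (k : ℕ) (s : Finset (Fin n)) :
    subsetSign k s = 1 ∨ subsetSign k s = -1 := by
  refine Int.isUnit_iff.1 ?_
  refine Finset.prod_induction _ IsUnit (fun _ _ => IsUnit.mul) isUnit_one fun i _ => ?_
  exact Int.isUnit_iff.2 (diagSign_eq_or k i)

/-- The number of elementary `q`-forms that `C_k` fixes. -/
def evenCount (n q k : ℕ) : ℕ :=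
  (((Finset.univ : Finset (Fin n)).powersetCard q).filter fun s => subsetSign k s = 1).card

/-- The number of elementary `q`-forms that `C_k` maps to their negatives. -/
def oddCount (n q k : ℕ) : ℕ :=
  (((Finset.univ : Finset (Fin n)).powersetCard q).filter fun s => subsetSign k s = -1).card

theorem subsetSign_ne_one_iff {n : ℕ} (k : ℕ) (s : Finset (Fin n)) :
    ¬ subsetSign k s = 1 ↔ subsetSign k s = -1 := by
  rcases subsetSign_eq_or k s with h | h <;> rw [h] <;> decide

theorem evenCount_add_oddCount (n q k : ℕ) : evenCount n q k + oddCount n q k = n.choose q := by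
  unfold evenCount oddCount
  simp only [← subsetSign_ne_one_iff]
  rw [Finset.card_filter_add_card_filter_not, Finset.card_powersetCard, Finset.card_univ,
    Fintype.card_fin]

theorem cardinal_sum_eq_sum {ι : Type} [h : Fintype ι] (f : ι → Cardinal.{0}) :
    Cardinal.sum f = ∑ i, f i := by
  revert f
  refine Fintype.induction_empty_option ?_ ?_ ?_ ι (h_fintype := h)
  · intro α β hβ e h f
    let := Fintype.ofEquiv β e.symm
    rw [← e.sum_comp f, ← h]
    exact Cardinal.mk_congr (Equiv.sigmaCongrLeft (β := fun b => (f b).out) e).symm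
  · intro f
    rw [Fintype.univ_pempty, Finset.sum_empty, Cardinal.sum, Cardinal.mk_eq_zero]
  · intro α hα h f
    let e : (Σ i, (f i).out) ≃ (f none).out ⊕ Σ a, (f (some a)).out :=
      ⟨fun x => match x with
        | ⟨none, y⟩ => Sum.inl y
        | ⟨some a, y⟩ => Sum.inr ⟨a, y⟩,
       fun x => match x with
        | Sum.inl y => ⟨none, y⟩
        | Sum.inr ⟨a, y⟩ => ⟨some a, y⟩,
       by rintro ⟨_ | a, y⟩ <;> rfl, by rintro (y | ⟨a, y⟩) <;> rfl⟩
    rw [Fintype.sum_option, ← h fun a => f (some a)]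
    refine (Cardinal.mk_congr e).trans ((Cardinal.add_def _ _).symm.trans ?_)
    rw [Cardinal.mk_out, Cardinal.mk_sigma]
    simp only [Cardinal.mk_out]

theorem rank_pi_eq_sum {ι M : Type} [Fintype ι] [AddCommGroup M] [Module ℝ M]
    (N : ι → Submodule ℝ M) :
    Module.rank ℝ ((i : ι) → N i) = ∑ i, Module.rank ℝ (N i) := by
  rw [rank_pi, cardinal_sum_eq_sum]

/-- The multiplicity formula. As an identity of cardinals it does not presuppose that the
eigenspaces have finite dimension. -/
theorem rank_hodgeEigenspace {n k q : ℕ} (hk : 0 < k) (l : ℝ) :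
    Module.rank ℝ (hodgeEigenspace (groupΓ n k) q l) =
      evenCount n q k *
        Module.rank ℝ (torusEigenspace n l ⊓ glideSpace n k 1 : Submodule ℝ (E n → ℝ)) +
      oddCount n q k *
        Module.rank ℝ (torusEigenspace n l ⊓ glideSpace n k (-1) : Submodule ℝ (E n → ℝ)) := by
  rw [(hodgeEigenspaceEquiv hk l).rank_eq, rank_pi_eq_sum fun I : Set.powersetCard (Fin n) q =>
    (torusEigenspace n l ⊓ glideSpace n k (formSign k I) : Submodule ℝ (E n → ℝ))]
  let r : ℤ → Cardinal := fun ε => Module.rank ℝ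
    (torusEigenspace n l ⊓ glideSpace n k ε : Submodule ℝ (E n → ℝ))
  have h : ∑ I : Set.powersetCard (Fin n) q, r (subsetSign k (I : Finset (Fin n))) =
      ∑ s ∈ (Finset.univ : Finset (Fin n)).powersetCard q, r (subsetSign k s) :=
    (Finset.sum_subtype (p := fun s => s ∈ Set.powersetCard (Fin n) q) _
      (fun s => by simp [Set.powersetCard.mem_iff]) fun s => r (subsetSign k s)).symm
  change ∑ I : Set.powersetCard (Fin n) q, r (subsetSign k (I : Finset (Fin n))) =
    evenCount n q k * r 1 + oddCount n q k * r (-1)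
  rw [h, ← Finset.sum_filter_add_sum_filter_not _ fun s => subsetSign k s = 1]
  simp only [subsetSign_ne_one_iff]
  congr 1
  · rw [Finset.sum_congr rfl (g := fun _ => r 1), Finset.sum_const, nsmul_eq_mul, evenCount]
    intro s hs
    rw [(Finset.mem_filter.1 hs).2]
  · rw [Finset.sum_congr rfl (g := fun _ => r (-1)), Finset.sum_const, nsmul_eq_mul, oddCount]
    intro s hs
    rw [(Finset.mem_filter.1 hs).2]

theorem subsetSign_univ {n k : ℕ} (hk : k ≤ n) :
    subsetSign k (Finset.univ : Finset (Fin n)) = (-1) ^ (n - k) := by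
  obtain ⟨d, rfl⟩ := Nat.exists_eq_add_of_le hk
  rw [subsetSign, Fin.prod_univ_add]
  simp [diagSign]

/-- In the middle degree the complement of index sets exchanges the two signs, because `C_k` has
determinant `-1`. -/
theorem evenCount_eq_oddCount {p k : ℕ} (hk : Odd k) (hkp : k < 2 * p) :
    evenCount (2 * p) p k = oddCount (2 * p) p k := by
  have hc : ∀ s : Finset (Fin (2 * p)), subsetSign k s * subsetSign k sᶜ = -1 := fun s => by
    have h := Finset.prod_mul_prod_compl s fun i : Fin (2 * p) => diagSign k i
    have h1 := subsetSign_univ hkp.le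
    rw [Odd.neg_one_pow (by grind)] at h1
    exact h.trans h1
  have hcard : ∀ s : Finset (Fin (2 * p)), s.card = p → sᶜ.card = p := fun s hs => by
    rw [Finset.card_compl, hs, Fintype.card_fin]; omega
  refine Finset.card_bij' (fun s _ => sᶜ) (fun s _ => sᶜ) ?_ ?_ (fun s _ => compl_compl s)
    (fun s _ => compl_compl s)
  · intro s hs
    simp only [Finset.mem_filter, Finset.mem_powersetCard_univ] at hs ⊢
    have := hc s
    rw [hs.2, one_mul] at this
    exact ⟨hcard s hs.1, this⟩
  · intro s hs
    simp only [Finset.mem_filter, Finset.mem_powersetCard_univ] at hs ⊢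
    have := hc s
    rw [hs.2] at this
    exact ⟨hcard s hs.1, by linarith⟩

theorem isospectral_middle {p k k' : ℕ} (hk : Odd k) (hkp : k < 2 * p) (hk' : Odd k')
    (hkp' : k' < 2 * p) : Isospectral p (groupΓ (2 * p) k) (groupΓ (2 * p) k') := by
  intro l
  have h : evenCount (2 * p) p k = evenCount (2 * p) p k' := by
    have h1 := evenCount_add_oddCount (2 * p) p k
    have h2 := evenCount_add_oddCount (2 * p) p k'
    have h3 := evenCount_eq_oddCount hk hkp
    have h4 := evenCount_eq_oddCount hk' hkp'
    omega
  rw [rank_hodgeEigenspace hk.pos, rank_hodgeEigenspace hk'.pos, ← evenCount_eq_oddCount hk hkp,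
    ← evenCount_eq_oddCount hk' hkp', ← mul_add, ← mul_add,
    rank_add_rank_eq_rank_torusEigenspace hk.pos, rank_add_rank_eq_rank_torusEigenspace hk'.pos, h]

/-! ### The two lowest eigenvalues -/

/-- If the eigenspace has a basis of eigenvectors of the involution, then the dimensions of its
symmetric and antisymmetric parts are found by counting signs. -/
theorem rank_torusEigenspace_inf_glideSpace {n k : ℕ} {l : ℝ} {ι : Type} [Fintype ι]
    {b : ι → E n → ℝ} (hb : LinearIndependent ℝ b) {s : ι → ℤ}
    (hs : ∀ j x, b j (glide n k x) = s j * b j x)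
    (hspan : torusEigenspace n l = Submodule.span ℝ (Set.range b)) (ε : ℤ) :
    Module.rank ℝ (torusEigenspace n l ⊓ glideSpace n k ε : Submodule ℝ (E n → ℝ)) =
      ((Finset.univ.filter fun j => s j = ε).card : Cardinal) := by
  have h : torusEigenspace n l ⊓ glideSpace n k ε =
      Submodule.span ℝ (Set.range fun j : {j // s j = ε} => b j) := by
    apply le_antisymm
    · rintro f ⟨hf, hg⟩
      rw [SetLike.mem_coe, hspan, Submodule.mem_span_range_iff_exists_fun] at hf
      obtain ⟨c, rfl⟩ := hf
      have h1 : ∑ j, (c j * (s j - ε)) • b j = 0 := by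
        funext x
        have h2 := hg x
        simp only [Finset.sum_apply, Pi.smul_apply, smul_eq_mul, hs, Finset.mul_sum] at h2
        rw [← sub_eq_zero, ← Finset.sum_sub_distrib] at h2
        simp only [Finset.sum_apply, Pi.smul_apply, smul_eq_mul, Pi.zero_apply]
        rw [← h2]
        exact Finset.sum_congr rfl fun j _ => by ring
      have h3 := Fintype.linearIndependent_iff.1 hb _ h1
      refine Submodule.sum_mem _ fun j _ => ?_
      by_cases hj : s j = ε
      · exact Submodule.smul_mem _ _ (Submodule.subset_span ⟨⟨j, hj⟩, rfl⟩)
      · have h4 : c j = 0 := (mul_eq_zero.1 (h3 j)).resolve_right fun h5 =>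
          hj (by exact_mod_cast sub_eq_zero.1 h5)
        rw [h4, zero_smul]
        exact Submodule.zero_mem _
    · rw [Submodule.span_le]
      rintro _ ⟨⟨j, hj⟩, rfl⟩
      refine ⟨?_, fun x => (hs j x).trans (by rw [hj])⟩
      rw [hspan]
      exact Submodule.subset_span ⟨j, rfl⟩
  have hli := hb.comp (fun j : {j // s j = ε} => (j : ι)) Subtype.val_injective
  rw [h]
  have h2 := rank_span hli
  rw [Cardinal.mk_range_eq _ hli.injective, Cardinal.mk_fintype, Fintype.card_subtype] at h2
  exact h2

theorem phase_eq {n : ℕ} (m : Fin n → ℤ) (x : E n) :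
    phase m x = ((2 * Real.pi * ∑ i, m i * x i : ℝ) : ℂ) * Complex.I := by
  rw [phase_apply]
  push_cast
  rw [Finset.mul_sum, Finset.sum_mul]
  exact Finset.sum_congr rfl fun i _ => by ring

theorem re_mul_exp_phase {n : ℕ} (c : ℂ) (m : Fin n → ℤ) (x : E n) :
    (c * Complex.exp (phase m x)).re = c.re * Real.cos (2 * Real.pi * ∑ i, m i * x i) -
      c.im * Real.sin (2 * Real.pi * ∑ i, m i * x i) := by
  rw [phase_eq, Complex.mul_re, Complex.exp_ofReal_mul_I_re, Complex.exp_ofReal_mul_I_im]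

theorem torusEigenspace_zero (n : ℕ) :
    torusEigenspace n 0 = Submodule.span ℝ (Set.range fun (_ : Unit) (_ : E n) => (1 : ℝ)) := by
  apply le_antisymm
  · rintro f ⟨hs, hp, hl⟩
    obtain ⟨c, hc⟩ := eq_sum_exp_of_partialLaplacian hp hs hl {0} fun m hm => by
      rw [mul_eq_zero, Finset.sum_eq_zero_iff_of_nonneg fun i _ => sq_nonneg _] at hm
      have h1 := hm.resolve_left (by positivity)
      rw [Finset.mem_singleton]
      funext i
      simpa using h1 i (Finset.mem_univ i)
    refine (Submodule.mem_span_range_iff_exists_fun ℝ).2 ⟨fun _ => (c 0).re, funext fun x => ?_⟩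
    have h1 := congrArg Complex.re (hc x)
    rw [Finset.sum_singleton, re_mul_exp_phase, Complex.ofReal_re] at h1
    simp [h1]
  · rw [Submodule.span_le]
    rintro _ ⟨_, rfl⟩
    refine ⟨contDiff_const, fun _ _ => rfl, fun x => ?_⟩
    simp [partialLaplacian]

/-- The constants are symmetric under the generator `C_k L_{e₁/2}`. -/
theorem rank_torusEigenspace_zero (n k : ℕ) (ε : ℤ) :
    Module.rank ℝ (torusEigenspace n 0 ⊓ glideSpace n k ε : Submodule ℝ (E n → ℝ)) =
      if ε = 1 then 1 else 0 := by
  have hli : LinearIndependent ℝ fun (_ : Unit) (_ : E n) => (1 : ℝ) := by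
    rw [linearIndependent_unique_iff]
    intro h
    simpa using congrFun h 0
  rw [rank_torusEigenspace_inf_glideSpace (s := fun _ => 1) hli (fun _ _ => by simp)
    (torusEigenspace_zero n)]
  by_cases h : ε = 1
  · simp [h]
  · simp [h, Ne.symm h]

/-- The functions `cos (2π x_i)` and `sin (2π x_i)`. -/
def trig (n : ℕ) : Fin n ⊕ Fin n → E n → ℝ :=
  Sum.elim (fun i x => Real.cos (2 * Real.pi * x i)) fun i x => Real.sin (2 * Real.pi * x i)

theorem fderiv_comp_coord {n : ℕ} {φ φ' : ℝ → ℝ} (hφ : ∀ t, HasDerivAt φ (φ' t) t) (j i : Fin n)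
    (x : E n) : fderiv ℝ (fun x : E n => φ (2 * Real.pi * x j)) x (EuclideanSpace.single i 1) =
      if i = j then 2 * Real.pi * φ' (2 * Real.pi * x j) else 0 := by
  have h1 : HasFDerivAt (fun x : E n => 2 * Real.pi * x j)
      ((2 * Real.pi) • (EuclideanSpace.proj j : E n →L[ℝ] ℝ)) x :=
    ((EuclideanSpace.proj j : E n →L[ℝ] ℝ).hasFDerivAt (x := x)).const_mul (2 * Real.pi)
  have h2 : fderiv ℝ (fun x : E n => φ (2 * Real.pi * x j)) x = _ :=
    ((hφ (2 * Real.pi * x j)).comp_hasFDerivAt x h1).fderiv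
  rw [h2]
  by_cases h : i = j
  · subst h; simp; ring
  · simp [h, Ne.symm h]

theorem partialLaplacian_comp_coord {n : ℕ} {φ φ' : ℝ → ℝ} (hφ : ∀ t, HasDerivAt φ (φ' t) t)
    (hφ' : ∀ t, HasDerivAt φ' (-φ t) t) (hs : ContDiff ℝ ∞ φ) (j : Fin n) (x : E n) :
    partialLaplacian (fun x : E n => φ (2 * Real.pi * x j)) x =
      -(4 * Real.pi ^ 2 * φ (2 * Real.pi * x j)) := by
  have hs' : ContDiff ℝ ∞ fun x : E n => φ (2 * Real.pi * x j) := hs.comp (by fun_prop)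
  rw [partialLaplacian_eq_sum hs', Finset.sum_eq_single j]
  · simp only [fderiv_comp_coord hφ, if_true]
    have h := fderiv_comp_coord (n := n) (φ := fun t => 2 * Real.pi * φ' t)
      (φ' := fun t => 2 * Real.pi * -φ t) (fun t => (hφ' t).const_mul _) j j x
    rw [h, if_pos rfl]
    ring
  · intro i _ hi
    simp only [fderiv_comp_coord hφ, hi, if_false]
    simp
  · simp

theorem trig_mem_torusEigenspace {n : ℕ} (j : Fin n ⊕ Fin n) :
    trig n j ∈ torusEigenspace n (4 * Real.pi ^ 2) := by
  have h : ∀ (m : Fin n → ℤ) (x : E n) (i : Fin n), 2 * Real.pi * (latticeVec m + x) i =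
      2 * Real.pi * x i + m i * (2 * Real.pi) := fun m x i => by
    rw [PiLp.add_apply, latticeVec_apply]; ring
  rcases j with i | i
  · refine ⟨Real.contDiff_cos.comp (by fun_prop), fun m x => ?_,
      partialLaplacian_comp_coord (φ' := fun t => -Real.sin t) Real.hasDerivAt_cos
        (fun t => (Real.hasDerivAt_sin t).neg) Real.contDiff_cos i⟩
    simp only [trig, Sum.elim_inl, h, Real.cos_add_int_mul_two_pi]
  · refine ⟨Real.contDiff_sin.comp (by fun_prop), fun m x => ?_,
      partialLaplacian_comp_coord Real.hasDerivAt_sin Real.hasDerivAt_cos Real.contDiff_sin i⟩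
    simp only [trig, Sum.elim_inr, h, Real.sin_add_int_mul_two_pi]

theorem linearIndependent_trig (n : ℕ) : LinearIndependent ℝ (trig n) := by
  rw [Fintype.linearIndependent_iff]
  intro g hg
  have h : ∀ (i : Fin n) (t : ℝ), ∑ j ∈ Finset.univ.erase i, g (Sum.inl j) +
      (g (Sum.inl i) * Real.cos (2 * Real.pi * t) +
        g (Sum.inr i) * Real.sin (2 * Real.pi * t)) = 0 := fun i t => by
    have h1 := congrFun hg (EuclideanSpace.single i t)
    simp only [Finset.sum_apply, Pi.smul_apply, smul_eq_mul, Fintype.sum_sum_type, trig,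
      Sum.elim_inl, Sum.elim_inr, Pi.zero_apply] at h1
    rw [← Finset.sum_erase_add _ _ (Finset.mem_univ i),
      Finset.sum_eq_single (f := fun j => g (Sum.inr j) * _) i] at h1
    · rw [Finset.sum_congr rfl (g := fun j => g (Sum.inl j))] at h1
      · simp only [PiLp.single_apply, if_true] at h1
        linarith
      · intro j hj
        simp [Finset.ne_of_mem_erase hj]
    · intro j _ hj
      simp [hj]
    · simp
  -- The points `t = 0, 1/2` isolate the coefficient of `cos`, and `t = ±1/4` that of `sin`.
  have e1 : 2 * Real.pi * (1 / 2) = Real.pi := by ring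
  have e2 : 2 * Real.pi * (1 / 4) = Real.pi / 2 := by ring
  have e3 : 2 * Real.pi * -(1 / 4) = -(Real.pi / 2) := by ring
  rintro (i | i)
  · have h0 := h i 0
    have h1 := h i (1 / 2)
    rw [e1] at h1
    simp at h0 h1
    linarith
  · have h0 := h i (1 / 4)
    have h1 := h i (-(1 / 4))
    rw [e2] at h0
    rw [e3] at h1
    simp at h0 h1
    linarith

/-- The integral vectors of length one are the vectors `± e_i`. -/
theorem eq_single_of_sum_sq_eq_one {n : ℕ} {m : Fin n → ℤ} (h : ∑ i, m i ^ 2 = 1) :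
    ∃ i, m = Pi.single i 1 ∨ m = Pi.single i (-1) := by
  obtain ⟨i, hi⟩ : ∃ i, m i ≠ 0 := by
    by_contra! h0
    simp [h0] at h
  rw [← Finset.sum_erase_add _ _ (Finset.mem_univ i)] at h
  have h0 : 0 ≤ ∑ j ∈ Finset.univ.erase i, m j ^ 2 := Finset.sum_nonneg fun j _ => sq_nonneg _
  have h1 : 0 < m i ^ 2 := by positivity
  have h2 : ∑ j ∈ Finset.univ.erase i, m j ^ 2 = 0 := by linarith
  rw [Finset.sum_eq_zero_iff_of_nonneg fun j _ => sq_nonneg _] at h2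
  have h3 : ∀ j ≠ i, m j = 0 := fun j hj => by
    simpa using h2 j (Finset.mem_erase.2 ⟨hj, Finset.mem_univ j⟩)
  have h4 : m = Pi.single i (m i) := by
    funext j
    rcases eq_or_ne j i with rfl | hj
    · simp
    · simp [hj, h3 j hj]
  have h5 : m i ^ 2 = 1 := by linarith
  rcases mul_self_eq_one_iff.1 ((sq _).symm.trans h5) with h6 | h6
  · exact ⟨i, Or.inl (by rw [h6] at h4; exact h4)⟩
  · exact ⟨i, Or.inr (by rw [h6] at h4; exact h4)⟩

theorem torusEigenspace_four_pi_sq (n : ℕ) :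
    torusEigenspace n (4 * Real.pi ^ 2) = Submodule.span ℝ (Set.range (trig n)) := by
  apply le_antisymm
  · rintro f ⟨hs, hp, hl⟩
    let S : Finset (Fin n → ℤ) := Finset.univ.image (fun i => Pi.single i 1) ∪
      Finset.univ.image fun i => Pi.single i (-1)
    obtain ⟨c, hc⟩ := eq_sum_exp_of_partialLaplacian hp hs hl S fun m hm => by
      have h1 : ∑ i, (m i : ℝ) ^ 2 = 1 := by
        have hpi : (4 * Real.pi ^ 2) ≠ 0 := by positivity
        exact mul_left_cancel₀ hpi (by rw [hm, mul_one])
      obtain ⟨i, h2 | h2⟩ := eq_single_of_sum_sq_eq_one (m := m) (by exact_mod_cast h1)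
      · exact Finset.mem_union_left _ (Finset.mem_image.2 ⟨i, Finset.mem_univ i, h2.symm⟩)
      · exact Finset.mem_union_right _ (Finset.mem_image.2 ⟨i, Finset.mem_univ i, h2.symm⟩)
    have hf : f = ∑ m ∈ S, fun x => (c m * Complex.exp (phase m x)).re := by
      funext x
      rw [Finset.sum_apply, ← Complex.re_sum, ← hc x, Complex.ofReal_re]
    have hsum : ∀ (i : Fin n) (a : ℤ) (x : E n),
        ∑ j, (Pi.single i a : Fin n → ℤ) j * x j = a * x i := fun i a x => by
      rw [Finset.sum_eq_single i]
      · simp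
      · intro j _ hj; simp [hj]
      · simp
    rw [hf]
    refine Submodule.sum_mem _ fun m hm => ?_
    simp only [re_mul_exp_phase]
    have hcos : ∀ i, trig n (Sum.inl i) ∈ Submodule.span ℝ (Set.range (trig n)) := fun i =>
      Submodule.subset_span ⟨_, rfl⟩
    have hsin : ∀ i, trig n (Sum.inr i) ∈ Submodule.span ℝ (Set.range (trig n)) := fun i =>
      Submodule.subset_span ⟨_, rfl⟩
    rcases Finset.mem_union.1 hm with h | h <;>
      obtain ⟨i, -, rfl⟩ := Finset.mem_image.1 h
    · convert! Submodule.sub_mem _ (Submodule.smul_mem _ (c (Pi.single i 1)).re (hcos i))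
        (Submodule.smul_mem _ (c (Pi.single i 1)).im (hsin i)) using 1
      funext x
      simp [hsum, trig]
    · convert! Submodule.add_mem _ (Submodule.smul_mem _ (c (Pi.single i (-1))).re (hcos i))
        (Submodule.smul_mem _ (c (Pi.single i (-1))).im (hsin i)) using 1
      funext x
      simp [hsum, trig]
  · rw [Submodule.span_le]
    rintro _ ⟨j, rfl⟩
    exact trig_mem_torusEigenspace j

/-- The signs by which the generator `C_k L_{e₁/2}` acts on `cos (2π x_i)` and `sin (2π x_i)`. -/
def trigSign (n k : ℕ) : Fin n ⊕ Fin n → ℤ :=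
  Sum.elim (fun i => if (i : ℕ) = 0 then -1 else 1)
    fun i => if (i : ℕ) = 0 then -1 else diagSign k i

theorem trig_glide {n k : ℕ} (hk : 0 < k) (j : Fin n ⊕ Fin n) (x : E n) :
    trig n j (glide n k x) = trigSign n k j * trig n j x := by
  have e : ∀ t : ℝ, 2 * Real.pi * (2⁻¹ + t) = 2 * Real.pi * t + Real.pi := fun t => by ring
  rcases j with i | i
  · by_cases hi : (i : ℕ) = 0
    · simp [trig, trigSign, glide_apply, halfE1_apply, hi, diagSign, hk, e]
    · rcases diagSign_eq_or k i with h | h <;>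
        simp [trig, trigSign, glide_apply, halfE1_apply, hi, h]
  · by_cases hi : (i : ℕ) = 0
    · simp [trig, trigSign, glide_apply, halfE1_apply, hi, diagSign, hk, e]
    · rcases diagSign_eq_or k i with h | h <;>
        simp [trig, trigSign, glide_apply, halfE1_apply, hi, h]

theorem card_filter_trigSign_neg_one {n k : ℕ} (hk : 0 < k) (hkn : k ≤ n) :
    (Finset.univ.filter fun j => trigSign n k j = -1).card = n - k + 2 := by
  obtain ⟨n, rfl⟩ : ∃ n', n = n' + 1 := ⟨n - 1, by omega⟩
  obtain ⟨k, rfl⟩ : ∃ k', k = k' + 1 := ⟨k - 1, by omega⟩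
  rw [Finset.card_filter, Fintype.sum_sum_type, Fin.sum_univ_succ, Fin.sum_univ_succ]
  have h : ∑ i : Fin n, (if trigSign (n + 1) (k + 1) (Sum.inr i.succ) = -1 then 1 else 0) =
      n - k := by
    have h1 : ∀ i : Fin n, (if trigSign (n + 1) (k + 1) (Sum.inr i.succ) = -1 then 1 else 0) =
        if (i : ℕ) < k then 0 else 1 := fun i => by
      by_cases hi : (i : ℕ) < k <;> simp [trigSign, diagSign, hi]
    simp only [h1]
    obtain ⟨d, rfl⟩ := Nat.exists_eq_add_of_le (Nat.le_of_succ_le_succ hkn)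
    rw [Fin.sum_univ_add]
    simp
  rw [h]
  simp [trigSign]
  omega

theorem rank_torusEigenspace_four_pi_sq_neg {n k : ℕ} (hk : 0 < k) (hkn : k ≤ n) :
    Module.rank ℝ (torusEigenspace n (4 * Real.pi ^ 2) ⊓ glideSpace n k (-1) :
      Submodule ℝ (E n → ℝ)) = ((n - k + 2 : ℕ) : Cardinal) := by
  rw [rank_torusEigenspace_inf_glideSpace (linearIndependent_trig n) (trig_glide hk)
    (torusEigenspace_four_pi_sq n), card_filter_trigSign_neg_one hk hkn]

theorem trigSign_eq_or (n k : ℕ) (j : Fin n ⊕ Fin n) :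
    trigSign n k j = 1 ∨ trigSign n k j = -1 := by
  rcases j with i | i <;> by_cases hi : (i : ℕ) = 0 <;> simp [trigSign, hi, diagSign_eq_or]

theorem rank_torusEigenspace_four_pi_sq_pos {n k : ℕ} (hk : 0 < k) (hkn : k ≤ n) :
    Module.rank ℝ (torusEigenspace n (4 * Real.pi ^ 2) ⊓ glideSpace n k 1 :
      Submodule ℝ (E n → ℝ)) = ((n + k - 2 : ℕ) : Cardinal) := by
  rw [rank_torusEigenspace_inf_glideSpace (linearIndependent_trig n) (trig_glide hk)
    (torusEigenspace_four_pi_sq n)]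
  have h := Finset.card_filter_add_card_filter_not (s := Finset.univ)
    fun j => trigSign n k j = -1
  have h1 : ∀ j, ¬ trigSign n k j = -1 ↔ trigSign n k j = 1 := fun j => by
    rcases trigSign_eq_or n k j with h | h <;> rw [h] <;> decide
  simp only [h1] at h
  rw [card_filter_trigSign_neg_one hk hkn, Finset.card_univ, Fintype.card_sum,
    Fintype.card_fin] at h
  congr 1
  omega

/-! ### Comparison of multiplicities -/

/-- Comparison of the multiplicities of the eigenvalue `0`. -/
theorem evenCount_eq_of_isospectral {n q k k' : ℕ} (hk : 0 < k) (hk' : 0 < k')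
    (h : Isospectral q (groupΓ n k) (groupΓ n k')) : evenCount n q k = evenCount n q k' := by
  have h0 := h 0
  rw [rank_hodgeEigenspace hk, rank_hodgeEigenspace hk'] at h0
  simpa [rank_torusEigenspace_zero] using h0

/-- Comparison of the multiplicities of the eigenvalue `4π²`. -/
theorem count_eq_of_isospectral {n q k k' : ℕ} (hk : 0 < k) (hkn : k ≤ n) (hk' : 0 < k')
    (hkn' : k' ≤ n) (h : Isospectral q (groupΓ n k) (groupΓ n k')) :
    evenCount n q k * (n + k - 2) + oddCount n q k * (n - k + 2) =
      evenCount n q k' * (n + k' - 2) + oddCount n q k' * (n - k' + 2) := by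
  have h0 := h (4 * Real.pi ^ 2)
  rw [rank_hodgeEigenspace hk, rank_hodgeEigenspace hk',
    rank_torusEigenspace_four_pi_sq_pos hk hkn, rank_torusEigenspace_four_pi_sq_pos hk' hkn',
    rank_torusEigenspace_four_pi_sq_neg hk hkn, rank_torusEigenspace_four_pi_sq_neg hk' hkn'] at h0
  exact_mod_cast h0

theorem evenCount_zero (n k : ℕ) : evenCount n 0 k = 1 := by
  simp [evenCount, subsetSign, Finset.filter_singleton]

theorem not_isospectral_zero {n k k' : ℕ} (hk : 0 < k) (hkn : k < n) (hk' : 0 < k')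
    (hkn' : k' < n) (hne : k ≠ k') : ¬ Isospectral 0 (groupΓ n k) (groupΓ n k') := fun h => by
  have h1 := count_eq_of_isospectral hk hkn.le hk' hkn'.le h
  have h2 := evenCount_add_oddCount n 0 k
  have h3 := evenCount_add_oddCount n 0 k'
  rw [evenCount_zero, Nat.choose_zero_right] at h2 h3
  rw [evenCount_zero, evenCount_zero, show oddCount n 0 k = 0 by omega,
    show oddCount n 0 k' = 0 by omega] at h1
  omega

theorem oddCount_top {n k : ℕ} (hkn : k ≤ n) (hodd : Odd (n - k)) : oddCount n n k = 1 := by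
  have h : (Finset.univ : Finset (Fin n)).powersetCard n = {Finset.univ} := by
    ext s
    rw [Finset.mem_powersetCard_univ, Finset.mem_singleton, ← Finset.card_eq_iff_eq_univ,
      Fintype.card_fin]
  rw [oddCount, h, Finset.filter_singleton, if_pos, Finset.card_singleton]
  rw [subsetSign_univ hkn, hodd.neg_one_pow]

theorem not_isospectral_top {n k k' : ℕ} (hk : 0 < k) (hkn : k < n) (hk' : 0 < k')
    (hkn' : k' < n) (hodd : Odd (n - k)) (hodd' : Odd (n - k')) (hne : k ≠ k') :
    ¬ Isospectral n (groupΓ n k) (groupΓ n k') := fun h => by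
  have h1 := count_eq_of_isospectral hk hkn.le hk' hkn'.le h
  have h2 := evenCount_add_oddCount n n k
  have h3 := evenCount_add_oddCount n n k'
  rw [oddCount_top hkn.le hodd, Nat.choose_self] at h2
  rw [oddCount_top hkn'.le hodd', Nat.choose_self] at h3
  rw [oddCount_top hkn.le hodd, oddCount_top hkn'.le hodd', show evenCount n n k = 0 by omega,
    show evenCount n n k' = 0 by omega] at h1
  omega

/-- `C_1` acts on `dx_I` by a sign that depends only on `|I|` and on whether `I` contains the first
index, so one of the two signs occurs for the subsets of an `(n - 1)`-element set. -/
theorem evenCount_one_or_oddCount_one (n q : ℕ) :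
    evenCount (n + 1) q 1 = n.choose q ∨ oddCount (n + 1) q 1 = n.choose q := by
  have h0 : ∀ s : Finset (Fin (n + 1)), 0 ∉ s → subsetSign 1 s = (-1) ^ s.card := fun s hs => by
    rw [subsetSign, Finset.prod_congr rfl (g := fun _ => (-1 : ℤ)), Finset.prod_const]
    intro i hi
    have : i ≠ 0 := fun h => hs (h ▸ hi)
    simp [diagSign, this]
  have h1 : ∀ s : Finset (Fin (n + 1)), 0 ∈ s → subsetSign 1 s = -(-1) ^ s.card := fun s hs => by
    have h2 := h0 (s.erase 0) (Finset.notMem_erase _ _)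
    rw [subsetSign, ← Finset.mul_prod_erase _ _ hs]
    rw [subsetSign] at h2
    rw [h2, ← Finset.card_erase_add_one hs, pow_succ]
    simp [diagSign]
  have hcard : (((Finset.univ : Finset (Fin (n + 1))).erase 0).powersetCard q).card =
      n.choose q := by
    rw [Finset.card_powersetCard, Finset.card_erase_of_mem (Finset.mem_univ _), Finset.card_univ,
      Fintype.card_fin, Nat.add_sub_cancel]
  have hmem : ∀ s : Finset (Fin (n + 1)), s ⊆ Finset.univ.erase 0 ↔ 0 ∉ s := fun s => by
    rw [Finset.subset_erase]; simp
  rcases Nat.even_or_odd q with hq | hq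
  · left
    rw [← hcard, evenCount]
    congr 1
    ext s
    rw [Finset.mem_filter, Finset.mem_powersetCard, Finset.mem_powersetCard, hmem]
    by_cases hs : 0 ∈ s
    · simp only [hs, not_true, false_and, iff_false, not_and]
      rintro ⟨-, h2⟩
      rw [h1 s hs, h2, hq.neg_one_pow]; decide
    · simp only [hs, not_false_eq_true, true_and, Finset.subset_univ, and_iff_left_iff_imp]
      intro h2
      rw [h0 s hs, h2, hq.neg_one_pow]
  · right
    rw [← hcard, oddCount]
    congr 1
    ext s
    rw [Finset.mem_filter, Finset.mem_powersetCard, Finset.mem_powersetCard, hmem]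
    by_cases hs : 0 ∈ s
    · simp only [hs, not_true, false_and, iff_false, not_and]
      rintro ⟨-, h2⟩
      rw [h1 s hs, h2, hq.neg_one_pow]; decide
    · simp only [hs, not_false_eq_true, true_and, Finset.subset_univ, and_iff_left_iff_imp]
      intro h2
      rw [h0 s hs, h2, hq.neg_one_pow]

theorem two_mul_eq_of_evenCount_eq_oddCount {n q : ℕ} (hq : q ≤ n + 1)
    (h : evenCount (n + 1) q 1 = oddCount (n + 1) q 1) : 2 * q = n + 1 := by
  have h1 := evenCount_add_oddCount (n + 1) q 1
  have h2 : 2 * n.choose q = (n + 1).choose q := by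
    rcases evenCount_one_or_oddCount_one n q with h2 | h2 <;> omega
  cases q with
  | zero => simp at h2
  | succ q =>
    rw [Nat.choose_succ_succ'] at h2
    have h3 := Nat.choose_succ_right_eq n q
    have h4 : n.choose (q + 1) = n.choose q := by omega
    rw [h4] at h3
    have h5 := Nat.eq_of_mul_eq_mul_left (Nat.choose_pos (by omega)) h3
    omega

/-- The eigenvalue `0` gives equal counts of signs for `C_1` and `C_3`. Between them, the dimensions
of the symmetric and antisymmetric parts at `4π²` are interchanged, so the two counts agree. -/
theorem not_isospectral_one_three {n q : ℕ} (hn : 3 ≤ n) (hq : q ≤ n) (hne : 2 * q ≠ n) :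
    ¬ Isospectral q (groupΓ n 1) (groupΓ n 3) := fun h => by
  have h1 := evenCount_eq_of_isospectral one_pos (by norm_num) h
  have h2 := count_eq_of_isospectral one_pos (by omega) (by norm_num) hn h
  have h3 := evenCount_add_oddCount n q 1
  have h4 := evenCount_add_oddCount n q 3
  have h5 : oddCount n q 3 = oddCount n q 1 := by omega
  obtain ⟨n, rfl⟩ : ∃ n', n = n' + 1 := ⟨n - 1, by omega⟩
  refine hne (two_mul_eq_of_evenCount_eq_oddCount hq ?_)
  rw [← h1, h5, show n + 1 + 1 - 2 = n by omega, show n + 1 - 1 + 2 = n + 2 by omega,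
    show n + 1 + 3 - 2 = n + 2 by omega, show n + 1 - 3 + 2 = n by omega] at h2
  nlinarith

end FlatManifold

end

theorem mainTheorem3 (p : ℕ) (hp : 2 ≤ p) :
    -- each group of the family is a Bieberbach group with holonomy group `ℤ₂`
    (∀ k : ℕ, Odd k → k < 2 * p →
      FlatManifold.IsBieberbach (FlatManifold.groupΓ (2 * p) k) ∧
      Nonempty (FlatManifold.holonomyGroup (FlatManifold.groupΓ (2 * p) k) ≃*
        Multiplicative (ZMod 2))) ∧
    -- pairwise: not isomorphic, `p`-isospectral, neither `0`- nor `n`-isospectral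
    (∀ k k' : ℕ, Odd k → k < 2 * p → Odd k' → k' < 2 * p → k ≠ k' →
      IsEmpty (FlatManifold.groupΓ (2 * p) k ≃* FlatManifold.groupΓ (2 * p) k') ∧
      FlatManifold.Isospectral p
        (FlatManifold.groupΓ (2 * p) k) (FlatManifold.groupΓ (2 * p) k') ∧
      ¬ FlatManifold.Isospectral 0
        (FlatManifold.groupΓ (2 * p) k) (FlatManifold.groupΓ (2 * p) k') ∧
      ¬ FlatManifold.Isospectral (2 * p)
        (FlatManifold.groupΓ (2 * p) k) (FlatManifold.groupΓ (2 * p) k')) ∧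
    -- the vanishing of the Krawtchouk values at odd points
    (∀ j : ℕ, Odd j → j ≤ 2 * p → FlatManifold.krawtchouk (2 * p) p j = 0) ∧
    -- the pair `Γ₁`, `Γ₃` is `q`-isospectral for no `q ≠ p`
    (∀ q : ℕ, q ≤ 2 * p → q ≠ p →
      ¬ FlatManifold.Isospectral q
        (FlatManifold.groupΓ (2 * p) 1) (FlatManifold.groupΓ (2 * p) 3)) := by
  refine ⟨fun k hk hkn => ?_, fun k k' hk hkn hk' hkn' hne => ?_, fun j hj hjp => ?_,
    fun q hq hne => ?_⟩
  · exact ⟨FlatManifold.isBieberbach_groupΓ (by omega) hk.pos,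
      FlatManifold.nonempty_holonomyGroup_mulEquiv hk.pos hkn⟩
  · exact ⟨FlatManifold.isEmpty_groupΓ_mulEquiv hk.pos hkn hk'.pos hkn' hne,
      FlatManifold.isospectral_middle hk hkn hk' hkn',
      FlatManifold.not_isospectral_zero hk.pos hkn hk'.pos hkn' hne,
      FlatManifold.not_isospectral_top hk.pos hkn hk'.pos hkn' (by grind) (by grind) hne⟩
  · exact FlatManifold.krawtchouk_eq_zero hj hjp
  · exact FlatManifold.not_isospectral_one_three (by omega) hq (by omega)
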